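/- **Theorem (FairDAG-RL Liveness).** *System.* There are $n$ replicas, of which at most $f$ are Byzantine (ever corrupted), and $n>\frac{(2\gamma+1)f}{2\gamma-1}$ for some $\gamma$ with $\frac12<\gamma\le 1$. A correct replica takes each valid transaction (identified by its digest) when it first receives it, gives it the next value of a counter as ordering indicator, and appends the pair (digest, indicator) to its pending list. It proposes one DAG vertex per round $r=0,1,2,\dots$, without ever stopping; the vertex contains the pending list, which is then cleared, and is reliably broadcast. Vertices cannot be forged. A vertex of round $r>0$ has strong edges to at least $n-f$ vertices of round $r-1$, among them its author's own, and at most $f$ weak edges to vertices of earlier rounds. When a leader vertex $L_r$ of round $r$ is committed, its subdag $A_r$ (the causal history of $L_r$ minus those of the leaders committed before) is sent to the fairness layer. The DAG layer satisfies * Agreement: if a correct replica commits $L_r$ with subdag $A_r$, then every correct replica eventually does; * Total Ascending Order: if a correct replica commits $A_r$ before $A_{r'}$, then $r<r'$, and no correct replica commits $A_{r'}$ before $A_r$; * Validity: if a correct replica broadcasts a vertex $v$, then each correct replica eventually commits a leader $L_r$ with $v\in A_r$. Moreover, if a correct replica receives a transaction, then every correct replica eventually receives it. *Fairness layer.* On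 receiving $A_r$, a correct replica records, for each entry $(d,oi)$ of a vertex of replica $i$ in $A_r$ with $d$ not yet ordered, the committed indicator $oi$ and the commit round $r$ of $d$ from $i$. Let $ap(d,r)$ be the number of replicas whose committed indicator for $d$ has commit round at most $r$, and let $weight(d_1,d_2)$ be the number of replicas with a lower committed indicator for $d_1$ than for $d_2$ (a missing indicator counts as $\infty$). All nodes are blank initially. A new dependency graph $G_r$ is appended to a queue; each digest that occurs in $A_r$, is not ordered and is still blank becomes solid if $ap(d,r)\ge n-f$, or else shaded if $ap(d,r)\ge\frac{n-f}2$, and is added to $G_r$ if it is no longer blank. In every queued graph, an edge is added between any two distinct nodes $d_1,d_2$ that have no edge yet and for which $weight(d_1,d_2)$ or $weight(d_2,d_1)$ is at least $\frac{n-f}{2}$; it leads from $d_1$ to $d_2$ if $weight(d_1,d_2)>weight(d_2,d_1)$, and ties are broken arbitrarily. Then, as long as the front graph of the queue is a tournament (there is an edge between each two distinct nodes), that graph is removed; its strongly connected components $S_1,\dots,S_s$ are taken in topological order; the components up to the last one that contains a solid node are appended to the final ordering, each along a Hamiltonian path; and the nodes of the remaining components (all remaining nodes, if there is no solid node) are re-added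 to the next graph $G_{r'}$ of the queue, or, if the queue is empty, to the next graph that is created once it is at the front. A re-added node $d$ is reclassified by $ap(d,r')$ (its type is kept if $ap(d,r')<\frac{n-f}2$), and edges of $G_{r'}$ are added by the same rule. *Claim.* In every such execution, for every correct replica $R$: 1. Every valid transaction that is received by a correct replica is eventually in the final ordering of $R$. 2. Every dependency graph $G_r$ created by $R$ eventually becomes a tournament and is removed from the queue as one; at that point it contains all nodes and edges that it ever had in the queue before. 3. Every digest $d$ whose node becomes shaded or solid at $R$ (in particular every shaded node that is re-added) is eventually in the final ordering of $R$; and there is a leader vertex committed by $R$, of some round $r^*$, such that $d$ is solid in every dependency graph $G_{r}$ with $r\ge r^*$ to which it is added. Hence a shaded node that is re-added is either ordered while still shaded, or eventually becomes solid and is ordered. -/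

import Mathlib

namespace FairDAG

/-! ### The DAG layer: vertices, references, causal histories -/

/-- The vertex that replica `i` proposes in round `r` is addressed by the pair `(i, r)`. -/
abbrev VertexId (n : ℕ) := Fin n × ℕ

/-- Contents of a vertex. `strong` lists the authors of the vertices of the previous round that are
referenced by strong edges, `weak` the targets of the weak edges, and `entries` is the slice of the
author's local ordering: digests paired with ordering indicators. -/
structure Vertex (n : ℕ) (D : Type*) where
  strong : Finset (Fin n)
  weak : Finset (VertexId n)
  entries : List (D × ℕ)

/-- All reliably broadcast vertices of an execution. Reliable broadcast delivers at most one vertex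
per author and round; `none` means that there is no such vertex. -/
abbrev DAG (n : ℕ) (D : Type*) := VertexId n → Option (Vertex n D)

/-- `v` references `w` by a strong or a weak edge. -/
def DAG.Ref {n : ℕ} {D : Type*} (G : DAG n D) (v w : VertexId n) : Prop :=
  ∃ x, G v = some x ∧ ((w.2 + 1 = v.2 ∧ w.1 ∈ x.strong) ∨ w ∈ x.weak)

/-- The causal history of `v`: all vertices reachable from `v`, including `v`. -/
def DAG.history {n : ℕ} {D : Type*} (G : DAG n D) (v : VertexId n) : Set (VertexId n) :=
  {w | Relation.ReflTransGen G.Ref v w}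

/-- Every vertex obeys the construction rules: after the first round it has at least `n - f` strong
edges to vertices of the previous round, among them the author's own previous vertex, and it has at
most `f` weak edges, to vertices of earlier rounds. -/
def DAG.Valid {n : ℕ} {D : Type*} (f : ℕ) (G : DAG n D) : Prop :=
  ∀ (i : Fin n) (r : ℕ) (x : Vertex n D), G (i, r) = some x →
    (0 < r → n - f ≤ x.strong.card ∧ i ∈ x.strong) ∧
    (∀ j ∈ x.strong, ∃ s, s + 1 = r ∧ (G (j, s)).isSome) ∧
    x.weak.card ≤ f ∧
    (∀ w ∈ x.weak, w.2 + 1 < r ∧ (G w).isSome)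

/-- The author and the local-ordering slice of a vertex. -/
def DAG.slice {n : ℕ} {D : Type*} (G : DAG n D) (v : VertexId n) : Fin n × List (D × ℕ) :=
  (v.1, ((G v).map Vertex.entries).getD [])

/-! ### Dependency graphs -/

inductive NodeType
  | blank
  | shaded
  | solid
  deriving DecidableEq

/-- The dependency graph `G_r` of round `round`. -/
structure Graph (D : Type*) where
  round : ℕ
  nodes : Finset D
  edges : Finset (D × D)

/-- There is an edge between each pair of distinct nodes. -/
def Graph.IsTournament {D : Type*} (G : Graph D) : Prop :=
  ∀ a ∈ G.nodes, ∀ b ∈ G.nodes, a ≠ b → (a, b) ∈ G.edges ∨ (b, a) ∈ G.edges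

instance {D : Type*} [DecidableEq D] (G : Graph D) : Decidable G.IsTournament := by
  unfold Graph.IsTournament
  infer_instance

/-- There is a (possibly empty) directed path from `a` to `b`. -/
def Graph.Reach {D : Type*} (G : Graph D) (a b : D) : Prop :=
  Relation.ReflTransGen (fun x y => (x, y) ∈ G.edges) a b

/-- `S` is a strongly connected component. -/
def Graph.IsSCC {D : Type*} (G : Graph D) (S : Finset D) : Prop :=
  ∃ a ∈ G.nodes, ∀ b, b ∈ S ↔ b ∈ G.nodes ∧ G.Reach a b ∧ G.Reach b a

/-- `L` lists every strongly connected component once, in a topological order of the condensation: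
no edge leads from a later component to an earlier one. -/
def Graph.IsTopSort {D : Type*} (G : Graph D) (L : List (Finset D)) : Prop :=
  (∀ S, S ∈ L ↔ G.IsSCC S) ∧ L.Nodup ∧
    L.Pairwise (fun S S' => ∀ a ∈ S', ∀ b ∈ S, (a, b) ∉ G.edges)

/-- `p` is a Hamiltonian path of the subgraph induced on `S`. -/
def Graph.IsHamiltonPath {D : Type*} (G : Graph D) (S : Finset D) (p : List D) : Prop :=
  p.Nodup ∧ (∀ d, d ∈ p ↔ d ∈ S) ∧ p.IsChain (fun a b => (a, b) ∈ G.edges)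

/-! ### The fairness layer -/

/-- State of the fairness layer of one replica.
* `ois d i`, `rounds d i`: the committed ordering indicator of `d` from replica `i` and the round in
  which it was committed (`⊤` if there is none);
* `type d`: the type of `node(d)`;
* `graphs`: the queue of dependency graphs that are not finalized yet, front first;
* `carried`: nodes of a finalized graph that wait to be re-added to the next graph;
* `final`: the final ordering computed so far;
* `finalized`: a record of the graphs removed from the queue, as they were on removal. -/
structure FairState (n : ℕ) (D : Type*) where
  ois : D → Fin n → ℕ∞
  rounds : D → Fin n → ℕ∞
  type : D → NodeType
  graphs : List (Graph D)
  carried : Finset D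
  final : List D
  finalized : List (Graph D)

namespace FairState

variable {n : ℕ} {D : Type*}

def init : FairState n D where
  ois := fun _ _ => ⊤
  rounds := fun _ _ => ⊤
  type := fun _ => .blank
  graphs := []
  carried := ∅
  final := []
  finalized := []

/-- `weight(a, b)`: the number of replicas with a lower committed indicator for `a` than for `b`. -/
def weight (s : FairState n D) (a b : D) : ℕ :=
  (Finset.univ.filter (fun i => s.ois a i < s.ois b i)).card

/-- `ap(d, r)`: the number of ordering indicators for `d` that are committed by round `r`. -/
def ap (s : FairState n D) (d : D) (r : ℕ) : ℕ :=
  (Finset.univ.filter (fun i => s.rounds d i ≤ (r : ℕ∞))).card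

/-- Classification of `node(d)` by `ap(d, r)`; the type is kept if `ap(d, r) < (n - f) / 2`. -/
def classify (f : ℕ) (s : FairState n D) (r : ℕ) (d : D) : NodeType :=
  if n - f ≤ s.ap d r then .solid
  else if n - f ≤ 2 * s.ap d r then .shaded
  else s.type d

end FairState

/-- What the protocol leaves to the implementation: the direction of an edge between two nodes of
equal weights, and which topological order and which Hamiltonian path are taken if there are any. -/
structure Choices (n : ℕ) (D : Type*) where
  tie : FairState n D → D → D → Bool
  tie_swap : ∀ s a b, a ≠ b → tie s b a = !(tie s a b)
  sccs : Graph D → List (Finset D)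
  sccs_spec : ∀ (G : Graph D) L, G.IsTopSort L → G.IsTopSort (sccs G)
  path : Graph D → Finset D → List D
  path_spec : ∀ (G : Graph D) S p, G.IsHamiltonPath S p → G.IsHamiltonPath S (path G S)

namespace FairState

variable {n : ℕ} {D : Type*} [DecidableEq D]

/-- Record the entry `e = (d, oi)` of a vertex of replica `i` in a subdag of round `r`. Digests that
are already ordered are ignored. -/
def record (r : ℕ) (i : Fin n) (s : FairState n D) (e : D × ℕ) : FairState n D :=
  if e.1 ∈ s.final then s
  else { s with
    ois := fun d j => if d = e.1 ∧ j = i then (e.2 : ℕ∞) else s.ois d j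
    rounds := fun d j => if d = e.1 ∧ j = i then (r : ℕ∞) else s.rounds d j }

def recordAll (r : ℕ) (A : List (Fin n × List (D × ℕ))) (s : FairState n D) : FairState n D :=
  A.foldl (fun s v => v.2.foldl (record r v.1) s) s

/-- The digests occurring in `A` that are not ordered yet. -/
def updatedNodes (A : List (Fin n × List (D × ℕ))) (s : FairState n D) : Finset D :=
  (A.flatMap (fun v => v.2.map Prod.fst)).toFinset.filter (fun d => d ∉ s.final)

/-- Push the graph `G_r`; its nodes are the updated nodes that were blank and no longer are. -/
def pushGraph (f r : ℕ) (U : Finset D) (s : FairState n D) : FairState n D :=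
  let new := U.filter (fun d => s.type d = .blank ∧ s.classify f r d ≠ .blank)
  { s with
    type := fun d => if d ∈ new then s.classify f r d else s.type d
    graphs := s.graphs ++ [⟨r, new, ∅⟩] }

/-- Between `a` and `b` an edge can be added, and it leads from `a` to `b`. -/
def Prefers (f : ℕ) (ch : Choices n D) (s : FairState n D) (a b : D) : Prop :=
  (n - f ≤ 2 * s.weight a b ∨ n - f ≤ 2 * s.weight b a) ∧
    (s.weight b a < s.weight a b ∨ (s.weight a b = s.weight b a ∧ ch.tie s a b = true))

instance (f : ℕ) (ch : Choices n D) (s : FairState n D) (a b : D) :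
    Decidable (s.Prefers f ch a b) := by
  unfold Prefers
  infer_instance

/-- Add an edge between each two nodes that have no edge and of which a weight has reached the
threshold `(n - f) / 2`. -/
def addEdges (f : ℕ) (ch : Choices n D) (s : FairState n D) (G : Graph D) : Graph D :=
  { G with
    edges := G.edges ∪ (G.nodes ×ˢ G.nodes).filter (fun p =>
      p.1 ≠ p.2 ∧ (p.1, p.2) ∉ G.edges ∧ (p.2, p.1) ∉ G.edges ∧ s.Prefers f ch p.1 p.2) }

/-- `G` after the carried nodes have been added to it, with the edges that can be added. -/
def readdGraph (f : ℕ) (ch : Choices n D) (s : FairState n D) (G : Graph D) : Graph D :=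
  s.addEdges f ch { G with nodes := G.nodes ∪ s.carried }

/-- The carried nodes are classified for the round of `G`, and nothing is carried any more. -/
def readdState (f : ℕ) (s : FairState n D) (G : Graph D) : FairState n D :=
  { s with
    type := fun d => if d ∈ s.carried then s.classify f G.round d else s.type d
    carried := ∅ }

/-- `S` contains no solid node. -/
def noSolid (s : FairState n D) (S : Finset D) : Bool :=
  decide (∀ d ∈ S, s.type d ≠ .solid)

/-- Finalize the tournament `G`: order the components up to the last one with a solid node along
Hamiltonian paths, and carry the nodes of the components behind it. -/
def order (ch : Choices n D) (s : FairState n D) (G : Graph D) : FairState n D :=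
  { s with
    final := s.final ++ (((ch.sccs G).rdropWhile s.noSolid).map (ch.path G)).flatten
    carried := ((ch.sccs G).rtakeWhile s.noSolid).foldr (· ∪ ·) ∅
    finalized := s.finalized ++ [G] }

/-- Ordering finalization on the given queue of graphs: re-add the carried nodes to the front graph;
if it is a tournament, remove and finalize it and go on with the next graph, otherwise stop. If the
queue runs empty, the carried nodes wait for the next graph. -/
def finalize (f : ℕ) (ch : Choices n D) : List (Graph D) → FairState n D → FairState n D
  | [], s => { s with graphs := [] }
  | G :: rest, s =>
    let G' := s.readdGraph f ch G
    let s' := s.readdState f G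
    if G'.IsTournament then finalize f ch rest (s'.order ch G')
    else { s' with graphs := G' :: rest }

/-- Processing of the subdag `A` of a leader vertex of round `r`. -/
def onSubdag (f : ℕ) (ch : Choices n D) (r : ℕ) (A : List (Fin n × List (D × ℕ)))
    (s : FairState n D) : FairState n D :=
  let s₁ := s.recordAll r A
  let s₂ := s₁.pushGraph f r (s.updatedNodes A)
  finalize f ch (s₂.graphs.map (s₂.addEdges f ch)) s₂

end FairState

/-! ### Replicas and executions -/

/-- What happens at a replica in one time step. `commit L A`: the leader vertex `L` is committed and
its subdag, listed as `A`, is sent to the fairness layer. -/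
inductive Event (n : ℕ) (Txn D : Type*)
  | idle
  | receive (T : Txn)
  | propose (x : Vertex n D)
  | commit (L : VertexId n) (A : List (VertexId n))

/-- Parameters of the protocol: the fault bound `f`, the digest function, the validity check for
transactions and the choices of the implementation. -/
structure Protocol (n : ℕ) (Txn D : Type*) where
  f : ℕ
  digest : Txn → D
  valid : Txn → Bool
  choices : Choices n D

/-- Local state of a replica. `received`: digests of all transactions taken so far; `pending`: the
local ordering not yet put into a vertex; `round`: the round of its next vertex; `leaders`: the
leader vertices committed so far. -/
structure ReplicaState (n : ℕ) (D : Type*) where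
  counter : ℕ
  received : List D
  pending : List (D × ℕ)
  round : ℕ
  leaders : List (VertexId n)
  fair : FairState n D

def ReplicaState.init {n : ℕ} {D : Type*} : ReplicaState n D :=
  ⟨0, [], [], 0, [], FairState.init⟩

/-- The state change of a correct replica. A transaction that was received before is not taken a
second time. -/
def ReplicaState.step {n : ℕ} {Txn D : Type*} [DecidableEq D] (P : Protocol n Txn D) (G : DAG n D)
    (s : ReplicaState n D) : Event n Txn D → ReplicaState n D
  | .idle => s
  | .receive T =>
    if P.valid T = true ∧ P.digest T ∉ s.received then
      { s with
        counter := s.counter + 1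
        received := s.received ++ [P.digest T]
        pending := s.pending ++ [(P.digest T, s.counter + 1)] }
    else s
  | .propose _ => { s with pending := [], round := s.round + 1 }
  | .commit L A =>
    { s with
      leaders := s.leaders ++ [L]
      fair := s.fair.onSubdag P.f P.choices L.2 (A.map G.slice) }

/-- An execution: the replicas that are never corrupted, the vertices reliably broadcast by all
replicas, and the event at each replica in each time step (of no meaning for Byzantine ones). -/
structure Execution (n : ℕ) (Txn D : Type*) where
  correct : Finset (Fin n)
  dag : DAG n D
  event : Fin n → ℕ → Event n Txn D

namespace Execution

variable {n : ℕ} {Txn D : Type*} [DecidableEq D]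

/-- State of replica `R` before its event at time `t`. -/
def state (P : Protocol n Txn D) (E : Execution n Txn D) (R : Fin n) : ℕ → ReplicaState n D
  | 0 => ReplicaState.init
  | t + 1 => (state P E R t).step P E.dag (E.event R t)

/-- State of the fairness layer of `R` before the event at time `t`. -/
def fair (P : Protocol n Txn D) (E : Execution n Txn D) (R : Fin n) (t : ℕ) : FairState n D :=
  (E.state P R t).fair

/-- `A` lists the vertices in the subdag of the leader `L`, given the leaders committed before, in
round-increasing order. -/
def IsSubdag (G : DAG n D) (before : List (VertexId n)) (L : VertexId n)
    (A : List (VertexId n)) : Prop :=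
  A.Nodup ∧ A.Pairwise (fun v w => v.2 ≤ w.2) ∧
    ∀ v, v ∈ A ↔ v ∈ G.history L ∧ ∀ L' ∈ before, v ∉ G.history L'

/-- The execution runs the protocol: at most `f` replicas are Byzantine; the vertices obey the
construction rules; a vertex proposed by a correct replica carries its pending local ordering and is
broadcast; a vertex in the name of a correct replica was proposed by it; correct replicas go on
proposing vertices; and the subdag of each committed leader is sent to the fairness layer. -/
structure Follows (P : Protocol n Txn D) (E : Execution n Txn D) : Prop where
  byzantine : (E.correctᶜ).card ≤ P.f
  dag_valid : E.dag.Valid P.f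
  propose_eq : ∀ R ∈ E.correct, ∀ t x, E.event R t = .propose x →
    x.entries = (E.state P R t).pending ∧ E.dag (R, (E.state P R t).round) = some x
  authentic : ∀ R ∈ E.correct, ∀ r x, E.dag (R, r) = some x →
    ∃ t, E.event R t = .propose x ∧ (E.state P R t).round = r
  proposes : ∀ R ∈ E.correct, ∀ t, ∃ t' ≥ t, ∃ x, E.event R t' = .propose x
  commit_eq : ∀ R ∈ E.correct, ∀ t L A, E.event R t = .commit L A →
    (E.dag L).isSome ∧ IsSubdag E.dag (E.state P R t).leaders L A

/-- Agreement of the DAG layer. -/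
def Agreement (E : Execution n Txn D) : Prop :=
  ∀ R ∈ E.correct, ∀ t L A, E.event R t = .commit L A →
    ∀ R' ∈ E.correct, ∃ t', E.event R' t' = .commit L A

/-- Total ascending order of the DAG layer. -/
def TotalAscendingOrder (E : Execution n Txn D) : Prop :=
  ∀ R ∈ E.correct, ∀ t₁ t₂ L₁ A₁ L₂ A₂, t₁ < t₂ →
    E.event R t₁ = .commit L₁ A₁ → E.event R t₂ = .commit L₂ A₂ →
    L₁.2 < L₂.2 ∧
      ∀ R' ∈ E.correct, ¬ ∃ u₁ u₂, u₂ < u₁ ∧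
        E.event R' u₁ = .commit L₁ A₁ ∧ E.event R' u₂ = .commit L₂ A₂

/-- Validity of the DAG layer: each vertex broadcast by a correct replica is eventually contained in
the subdag of a leader vertex committed by each correct replica. -/
def Validity (P : Protocol n Txn D) (E : Execution n Txn D) : Prop :=
  ∀ R ∈ E.correct, ∀ t x, E.event R t = .propose x →
    ∀ R' ∈ E.correct, ∃ t' L A, E.event R' t' = .commit L A ∧ (R, (E.state P R t).round) ∈ A

/-- If a correct replica receives a transaction, then every correct replica eventually does. -/
def EventualReceipt (E : Execution n Txn D) : Prop :=
  ∀ T, ∀ R ∈ E.correct, ∀ t, E.event R t = .receive T →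
    ∀ R' ∈ E.correct, ∃ t', E.event R' t' = .receive T

end Execution

end FairDAG

/-! The bound on `n` enters only as `2f < n - f` (`two_mul_lt_sub`). It makes the shading threshold
`(n - f) / 2` exceed `f`, so a node that is not blank has an indicator from some correct replica.
That replica took a valid transaction; hence all correct replicas receive it, give it an indicator
and propose it, and by validity these at least `n - f` entries are all committed at `R`. So there is
a leader round `ρ` by which all correct indicators of the digest are recorded, unless it is ordered
before that (`exists_commit_forall_rounds_le`).

The queue drains. A correct replica gives distinct digests distinct indicators, so for two digests
with all correct indicators present it counts towards one of the two weights. These add up to at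
least `n - f`, and the larger one reaches the edge threshold (`weight_add_weight_ge`,
`isTournament_addEdges`). Between events nothing is carried while the queue is nonempty, so the
front graph has a fixed finite node set; at some commit all its pairs can be joined and it is
removed (`exists_finalized_of_head`). Since rounds increase along the queue, induction on the round
disposes of every graph.

Every node is ordered. In a graph of round at least `ρ` the digest has `ap ≥ n - f`; there it is
solid, and solid nodes are never carried, so removal of the graph orders it. A digest that is never
ordered would therefore lie in graphs of rounds below `ρ` only. Once these are gone it has to be
carried with an empty queue, but then the next graph, of a round at least `ρ`, receives it
(`exists_mem_final_of_ne_blank`).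

The bookkeeping is in `FairState.Inv`: the nonblank nodes are those ordered, carried or queued, and
the clauses on solid nodes refer to the current value of `ap`. This is sound because later commits
never raise `ap d ρ` for an earlier round `ρ` (`ap_recordAll_le`). -/

namespace FairDAG

/-! ### Hamiltonian paths and topological orders of condensations -/

theorem exists_perm_cons_isChain {D : Type*} {r : D → D → Prop} {a : D} :
    ∀ (l : List D) (b : D), (b :: l).IsChain r → r b a → (∀ c ∈ l, r a c ∨ r c a) →
      ∃ p : List D, p.Perm (a :: l) ∧ (b :: p).IsChain r
  | [], b, _, hba, _ => ⟨[a], List.Perm.refl _, by simpa using hba⟩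
  | c :: l, b, h, hba, hl => by
    rw [List.isChain_cons_cons] at h
    -- The new element goes in front of the first `c` with `r a c`; every element passed over is
    -- related to `a` in the other direction. The head `b` stays in place, so that the recursion can
    -- prepend to the result.
    by_cases hac : r a c
    · exact ⟨a :: c :: l, List.Perm.refl _, by simp [List.isChain_cons_cons, hba, hac, h.2]⟩
    · have hca : r c a := (hl c (by simp)).resolve_left hac
      obtain ⟨p, hp, hp'⟩ := exists_perm_cons_isChain l c h.2 hca
        fun x hx => hl x (List.mem_cons_of_mem _ hx)
      exact ⟨c :: p, (hp.cons c).trans (List.Perm.swap _ _ _),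
        List.isChain_cons_cons.2 ⟨h.1, hp'⟩⟩

/-- Rédei's theorem for semicomplete relations on a finite set. -/
theorem exists_hamiltonian_list {D : Type*} [DecidableEq D] {r : D → D → Prop} (S : Finset D) :
    (∀ a ∈ S, ∀ b ∈ S, a ≠ b → r a b ∨ r b a) →
      ∃ p : List D, p.Nodup ∧ (∀ d, d ∈ p ↔ d ∈ S) ∧ p.IsChain r := by
  induction S using Finset.induction_on with
  | empty => exact fun _ => ⟨[], by simp⟩
  | insert a S ha ih =>
    intro h
    obtain ⟨p, hnd, hmem, hch⟩ := ih fun x hx y hy =>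
      h x (Finset.mem_insert_of_mem hx) y (Finset.mem_insert_of_mem hy)
    have hap : ∀ c ∈ p, r a c ∨ r c a := fun c hc => by
      have hcS := (hmem c).1 hc
      exact h a (Finset.mem_insert_self _ _) c (Finset.mem_insert_of_mem hcS)
        (fun e => ha (e ▸ hcS))
    have key : ∃ q : List D, q.Perm (a :: p) ∧ q.IsChain r := by
      cases p with
      | nil => exact ⟨[a], List.Perm.refl _, by simp⟩
      | cons b l =>
        by_cases hab : r a b
        · exact ⟨a :: b :: l, List.Perm.refl _, List.isChain_cons_cons.2 ⟨hab, hch⟩⟩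
        · obtain ⟨q, hq, hq'⟩ := exists_perm_cons_isChain l b hch
            ((hap b (by simp)).resolve_left hab) fun c hc => hap c (List.mem_cons_of_mem _ hc)
          exact ⟨b :: q, (hq.cons b).trans (List.Perm.swap _ _ _), hq'⟩
    obtain ⟨q, hq, hq'⟩ := key
    refine ⟨q, hq.nodup_iff.2 (List.nodup_cons.2 ⟨fun h' => ha ((hmem a).1 h'), hnd⟩),
      fun d => ?_, hq'⟩
    rw [hq.mem_iff, List.mem_cons, Finset.mem_insert, hmem]

namespace Graph

variable {D : Type*}

theorem IsSCC.eq_of_mem {G : Graph D} {S S' : Finset D} (hS : G.IsSCC S) (hS' : G.IsSCC S')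
    {a : D} (ha : a ∈ S) (ha' : a ∈ S') : S = S' := by
  obtain ⟨x, -, hx⟩ := hS
  obtain ⟨y, -, hy⟩ := hS'
  have h1 := ((hx a).1 ha).2
  have h2 := ((hy a).1 ha').2
  ext b
  rw [hx, hy]
  exact ⟨fun h => ⟨h.1, h2.1.trans (h1.2.trans h.2.1), h.2.2.trans (h1.1.trans h2.2)⟩,
    fun h => ⟨h.1, h1.1.trans (h2.2.trans h.2.1), h.2.2.trans (h2.1.trans h1.2)⟩⟩

theorem exists_isSCC [DecidableEq D] {G : Graph D} {d : D} (hd : d ∈ G.nodes) :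
    ∃ S, G.IsSCC S ∧ d ∈ S := by
  classical
  refine ⟨G.nodes.filter fun b => G.Reach d b ∧ G.Reach b d, ⟨d, hd, by simp⟩, ?_⟩
  exact Finset.mem_filter.2 ⟨hd, Relation.ReflTransGen.refl, Relation.ReflTransGen.refl⟩

/-- The components are sorted by decreasing number of nodes reachable from them. An edge from a
later to an earlier component makes the reachable set of the earlier one a subset of the other; by
the sorting the two sets are equal, and the components coincide. Existence matters because
`Choices.sccs_spec` promises something only if some topological order exists. -/
theorem exists_isTopSort [DecidableEq D] (G : Graph D) : ∃ L, G.IsTopSort L := by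
  classical
  let scc : D → Finset D := fun a => G.nodes.filter fun b => G.Reach a b ∧ G.Reach b a
  let reached : Finset D → Finset D := fun S => G.nodes.filter fun b => ∃ a ∈ S, G.Reach a b
  let le : Finset D → Finset D → Bool := fun S S' => decide ((reached S').card ≤ (reached S).card)
  let L := (G.nodes.image scc).toList.mergeSort le
  have hperm : L.Perm (G.nodes.image scc).toList := List.mergeSort_perm _ _
  have hnd : L.Nodup := hperm.nodup_iff.2 (Finset.nodup_toList _)
  have hmem : ∀ S, S ∈ L ↔ G.IsSCC S := by
    intro S
    rw [hperm.mem_iff, Finset.mem_toList, Finset.mem_image]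
    constructor
    · rintro ⟨a, ha, rfl⟩
      exact ⟨a, ha, by simp [scc]⟩
    · rintro ⟨a, ha, h⟩
      exact ⟨a, ha, by ext b; simp [scc, h]⟩
  have hsorted : L.Pairwise fun S S' => le S S' = true :=
    List.pairwise_mergeSort (fun a b c h1 h2 => by simp only [le, decide_eq_true_eq] at *; omega)
      (fun a b => by simp only [le, Bool.or_eq_true, decide_eq_true_eq]; omega) _
  refine ⟨L, hmem, hnd, ?_⟩
  refine (hsorted.and hnd).imp_of_mem ?_
  rintro S S' hS hS' ⟨hle, hne⟩ a ha b hb hab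
  have hle : (reached S').card ≤ (reached S).card := by simpa [le] using hle
  have hS := (hmem S).1 hS
  have hS' := (hmem S').1 hS'
  have hSS := hS
  obtain ⟨x, hx, hxS⟩ := hS
  obtain ⟨y, hy, hyS⟩ := hS'
  have hsub : reached S ⊆ reached S' := by
    intro c hc
    simp only [reached, Finset.mem_filter] at hc ⊢
    obtain ⟨hcn, e, he, hec⟩ := hc
    refine ⟨hcn, a, ha, ?_⟩
    have h1 : G.Reach a b := Relation.ReflTransGen.single hab
    exact h1.trans (((hxS b).1 hb).2.2.trans (((hxS e).1 he).2.1.trans hec))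
  have heq := Finset.eq_of_subset_of_card_le hsub hle
  have ha' : a ∈ reached S := by
    rw [heq]
    simp only [reached, Finset.mem_filter]
    exact ⟨((hyS a).1 ha).1, a, ha, Relation.ReflTransGen.refl⟩
  simp only [reached, Finset.mem_filter] at ha'
  obtain ⟨han, e, he, hea⟩ := ha'
  have : a ∈ S := (hxS a).2 ⟨han, ((hxS e).1 he).2.1.trans hea,
    Relation.ReflTransGen.head hab ((hxS b).1 hb).2.2⟩
  exact hne (hSS.eq_of_mem ⟨y, hy, hyS⟩ this ha)

end Graph

namespace Choices

variable {n : ℕ} {D : Type*} [DecidableEq D] (ch : Choices n D)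

theorem isTopSort_sccs (G : Graph D) : G.IsTopSort (ch.sccs G) :=
  let ⟨L, hL⟩ := G.exists_isTopSort
  ch.sccs_spec G L hL

/-- A component of a tournament is itself a tournament, so a Hamiltonian path exists and `path_spec`
applies. -/
theorem mem_path_iff {G : Graph D} (hG : G.IsTournament) {S : Finset D} (hS : G.IsSCC S) (d : D) :
    d ∈ ch.path G S ↔ d ∈ S := by
  obtain ⟨x, -, hx⟩ := hS
  obtain ⟨p, hp⟩ := exists_hamiltonian_list (r := fun a b => (a, b) ∈ G.edges) S
    fun a ha b hb => hG a ((hx a).1 ha).1 b ((hx b).1 hb).1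
  exact (ch.path_spec G S p hp).2.1 d

theorem mem_nodes_iff (G : Graph D) (d : D) : d ∈ G.nodes ↔ ∃ S ∈ ch.sccs G, d ∈ S := by
  constructor
  · intro hd
    obtain ⟨S, hS, hdS⟩ := Graph.exists_isSCC hd
    exact ⟨S, ((ch.isTopSort_sccs G).1 S).2 hS, hdS⟩
  · rintro ⟨S, hS, hdS⟩
    obtain ⟨x, -, hx⟩ := ((ch.isTopSort_sccs G).1 S).1 hS
    exact ((hx d).1 hdS).1

end Choices

/-! ### Removal of one tournament from the queue -/

namespace FairState

variable {n : ℕ} {D : Type*} [DecidableEq D]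

theorem mem_foldr_union (L : List (Finset D)) (d : D) :
    d ∈ L.foldr (· ∪ ·) ∅ ↔ ∃ S ∈ L, d ∈ S := by
  induction L with
  | nil => simp
  | cons S L ih => simp [ih]

theorem mem_carried_order (ch : Choices n D) (s : FairState n D) (G : Graph D) (d : D) :
    d ∈ (s.order ch G).carried ↔ ∃ S ∈ (ch.sccs G).rtakeWhile s.noSolid, d ∈ S :=
  mem_foldr_union _ d

theorem carried_order_subset (ch : Choices n D) (s : FairState n D) (G : Graph D) :
    (s.order ch G).carried ⊆ G.nodes := by
  intro d hd
  obtain ⟨S, hS, hdS⟩ := (mem_carried_order ch s G d).1 hd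
  exact (ch.mem_nodes_iff G d).2 ⟨S, (List.rtakeWhile_suffix _ _).subset hS, hdS⟩

theorem type_ne_solid_of_mem_carried_order (ch : Choices n D) (s : FairState n D) (G : Graph D)
    {d : D} (hd : d ∈ (s.order ch G).carried) : s.type d ≠ .solid := by
  obtain ⟨S, hS, hdS⟩ := (mem_carried_order ch s G d).1 hd
  have := List.mem_rtakeWhile_imp hS
  simp only [noSolid, decide_eq_true_eq] at this
  exact this d hdS

/-- The list of components splits into an ordered prefix and a carried suffix. Components are
disjoint and listed once, so no node lies in both parts. -/
theorem mem_final_order (ch : Choices n D) (s : FairState n D) {G : Graph D} (hG : G.IsTournament)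
    (d : D) : d ∈ (s.order ch G).final ↔
      d ∈ s.final ∨ (d ∈ G.nodes ∧ d ∉ (s.order ch G).carried) := by
  have hL := ch.isTopSort_sccs G
  have happ := List.rdropWhile_append_rtakeWhile (p := s.noSolid) (l := ch.sccs G)
  have hnd := hL.2.1
  rw [← happ, List.nodup_append] at hnd
  have hsub : ∀ S ∈ (ch.sccs G).rdropWhile s.noSolid, S ∈ ch.sccs G :=
    (List.rdropWhile_prefix _ _).subset
  rw [mem_carried_order]
  simp only [order, List.mem_append, List.mem_flatten, List.mem_map]
  refine or_congr_right ⟨?_, ?_⟩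
  · rintro ⟨_, ⟨S, hS, rfl⟩, hd⟩
    have hSL := hsub S hS
    have hdS := (ch.mem_path_iff hG ((hL.1 S).1 hSL) d).1 hd
    refine ⟨(ch.mem_nodes_iff G d).2 ⟨S, hSL, hdS⟩, ?_⟩
    rintro ⟨S', hS', hdS'⟩
    have hSL' := (List.rtakeWhile_suffix s.noSolid _).subset hS'
    exact hnd.2.2 S hS S' hS' (((hL.1 S).1 hSL).eq_of_mem ((hL.1 S').1 hSL') hdS hdS')
  · rintro ⟨hd, hnot⟩
    obtain ⟨S, hS, hdS⟩ := (ch.mem_nodes_iff G d).1 hd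
    have hS' := hS
    rw [← happ, List.mem_append] at hS'
    rcases hS' with hS' | hS'
    · exact ⟨_, ⟨S, hS', rfl⟩, (ch.mem_path_iff hG ((hL.1 S).1 hS) d).2 hdS⟩
    · exact absurd ⟨S, hS', hdS⟩ hnot

end FairState
end FairDAG

/-! ### The invariant of the fairness layer and its preservation -/

namespace FairDAG

/-- `H` is a later form of the dependency graph `G`. -/
def Graph.Extends {D : Type*} (G H : Graph D) : Prop :=
  H.round = G.round ∧ G.nodes ⊆ H.nodes ∧ G.edges ⊆ H.edges

theorem Graph.Extends.refl {D : Type*} (G : Graph D) : G.Extends G :=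
  ⟨rfl, subset_rfl, subset_rfl⟩

theorem Graph.Extends.trans {D : Type*} {G H K : Graph D} (h : G.Extends H) (h' : H.Extends K) :
    G.Extends K :=
  ⟨h'.1.trans h.1, h.2.1.trans h'.2.1, h.2.2.trans h'.2.2⟩

namespace FairState

variable {n : ℕ} {D : Type*} [DecidableEq D]

theorem recordAll_eq_foldl (r : ℕ) (A : List (Fin n × List (D × ℕ))) (s : FairState n D) :
    recordAll r A s = (A.flatMap fun v => v.2.map (Prod.mk v.1)).foldl
      (fun s p => record r p.1 s p.2) s := by
  simp [recordAll, List.foldl_flatMap, List.foldl_map]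

theorem recordAll_induction {r : ℕ} {A : List (Fin n × List (D × ℕ))}
    {motive : FairState n D → Prop} {s : FairState n D} (base : motive s)
    (step : ∀ t i e, (∃ v ∈ A, v.1 = i ∧ e ∈ v.2) → motive t → motive (record r i t e)) :
    motive (recordAll r A s) := by
  rw [recordAll_eq_foldl]
  have hA : ∀ p ∈ A.flatMap (fun v => v.2.map (Prod.mk v.1)), ∃ v ∈ A, v.1 = p.1 ∧ p.2 ∈ v.2 := by
    rintro ⟨i, e⟩ hp
    simp only [List.mem_flatMap, List.mem_map, Prod.mk.injEq] at hp
    obtain ⟨v, hv, e', he', h1, rfl⟩ := hp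
    exact ⟨v, hv, h1, he'⟩
  generalize A.flatMap (fun v => v.2.map (Prod.mk v.1)) = l at hA
  induction l generalizing s with
  | nil => exact base
  | cons p l ih =>
    exact ih (step s p.1 p.2 (hA p (by simp)) base) fun q hq => hA q (List.mem_cons_of_mem _ hq)

theorem record_frame (r : ℕ) (i : Fin n) (s : FairState n D) (e : D × ℕ) :
    (record r i s e).type = s.type ∧ (record r i s e).graphs = s.graphs ∧
      (record r i s e).carried = s.carried ∧ (record r i s e).final = s.final ∧
      (record r i s e).finalized = s.finalized := by
  unfold record
  split <;> simp

theorem recordAll_frame (r : ℕ) (A : List (Fin n × List (D × ℕ))) (s : FairState n D) :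
    (recordAll r A s).type = s.type ∧ (recordAll r A s).graphs = s.graphs ∧
      (recordAll r A s).carried = s.carried ∧ (recordAll r A s).final = s.final ∧
      (recordAll r A s).finalized = s.finalized := by
  refine recordAll_induction (motive := fun t => t.type = s.type ∧ t.graphs = s.graphs ∧
      t.carried = s.carried ∧ t.final = s.final ∧ t.finalized = s.finalized)
    ⟨rfl, rfl, rfl, rfl, rfl⟩ fun t i e _ h => ?_
  obtain ⟨h1, h2, h3, h4, h5⟩ := record_frame r i t e
  exact ⟨h1.trans h.1, h2.trans h.2.1, h3.trans h.2.2.1, h4.trans h.2.2.2.1, h5.trans h.2.2.2.2⟩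

theorem rounds_recordAll_cases (r : ℕ) (A : List (Fin n × List (D × ℕ))) (s : FairState n D)
    (d : D) (i : Fin n) :
    ((recordAll r A s).rounds d i = s.rounds d i ∧ (recordAll r A s).ois d i = s.ois d i) ∨
    ((recordAll r A s).rounds d i = (r : ℕ∞) ∧
      ∃ k : ℕ, (recordAll r A s).ois d i = (k : ℕ∞) ∧ ∃ v ∈ A, v.1 = i ∧ (d, k) ∈ v.2) := by
  refine recordAll_induction (motive := fun t => (t.rounds d i = s.rounds d i ∧
    t.ois d i = s.ois d i) ∨ (t.rounds d i = (r : ℕ∞) ∧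
      ∃ k : ℕ, t.ois d i = (k : ℕ∞) ∧ ∃ v ∈ A, v.1 = i ∧ (d, k) ∈ v.2))
    (Or.inl ⟨rfl, rfl⟩) fun t j e he h => ?_
  unfold record
  split
  · exact h
  · by_cases hc : d = e.1 ∧ i = j
    · obtain ⟨rfl, rfl⟩ := hc
      exact Or.inr ⟨by simp, e.2, by simp, he⟩
    · simpa only [hc, if_false] using h

theorem rounds_recordAll_of_mem {r : ℕ} {A : List (Fin n × List (D × ℕ))} {s : FairState n D}
    {d : D} {i : Fin n} (hd : d ∉ s.final) {v : Fin n × List (D × ℕ)} (hv : v ∈ A) (hvi : v.1 = i)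
    {k : ℕ} (hk : (d, k) ∈ v.2) : (recordAll r A s).rounds d i = (r : ℕ∞) := by
  rw [recordAll_eq_foldl]
  have hmem : (i, (d, k)) ∈ A.flatMap fun v => v.2.map (Prod.mk v.1) :=
    List.mem_flatMap.2 ⟨v, hv, List.mem_map.2 ⟨_, hk, by rw [hvi]⟩⟩
  generalize A.flatMap (fun v => v.2.map (Prod.mk v.1)) = l at hmem
  -- A further entry for `d` from `i` in the same subdag may replace the indicator, but it writes
  -- the same round `r`.
  have keep : ∀ (l : List (Fin n × D × ℕ)) (t : FairState n D), t.rounds d i = (r : ℕ∞) →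
      (l.foldl (fun s p => record r p.1 s p.2) t).rounds d i = (r : ℕ∞) := by
    intro l
    induction l with
    | nil => exact fun t h => h
    | cons p l ih =>
      intro t h
      refine ih _ ?_
      change (record r p.1 t p.2).rounds d i = _
      unfold record
      split
      · exact h
      · simp [h]
  induction l generalizing s with
  | nil => simp at hmem
  | cons p l ih =>
    rcases List.mem_cons.1 hmem with rfl | hmem
    · refine keep l _ ?_
      simp [record, hd]
    · exact ih (by rwa [(record_frame r p.1 s p.2).2.2.2.1]) hmem

/-- Recording in round `r` only writes the commit round `r > ρ`. The inequality can be strict: a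
Byzantine replica may repeat a digest and overwrite an earlier commit round. This direction is the
useful one: a bound `n - f ≤ ap` seen later already held when the node was classified. -/
theorem ap_recordAll_le {r ρ : ℕ} (hρ : ρ < r) (A : List (Fin n × List (D × ℕ)))
    (s : FairState n D) (d : D) : (recordAll r A s).ap d ρ ≤ s.ap d ρ := by
  refine Finset.card_le_card fun i hi => ?_
  simp only [Finset.mem_filter, Finset.mem_univ, true_and] at hi ⊢
  rcases rounds_recordAll_cases r A s d i with h | h
  · rwa [h.1] at hi
  · rw [h.1, Nat.cast_le] at hi
    omega

omit [DecidableEq D] in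
theorem classify_ne_blank_iff {f r : ℕ} {s : FairState n D} {d : D} :
    s.classify f r d ≠ .blank ↔ s.type d ≠ .blank ∨ n - f ≤ 2 * s.ap d r := by
  unfold classify
  split_ifs with h1 h2
  · simp only [ne_eq, reduceCtorEq, not_false_eq_true, true_iff]
    omega
  · simp [h2]
  · simp [h2]

omit [DecidableEq D] in
theorem classify_eq_solid {f r : ℕ} {s : FairState n D} {d : D} (h : n - f ≤ s.ap d r) :
    s.classify f r d = .solid := if_pos h

/-- Invariant of the fairness layer with the queue `q` of dependency graphs. -/
structure Inv (f : ℕ) (q : List (Graph D)) (s : FairState n D) : Prop where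
  sorted : (s.finalized.map Graph.round ++ q.map Graph.round).Pairwise (· < ·)
  disjoint : (q.map Graph.nodes).Pairwise Disjoint
  disjoint_carried : ∀ G ∈ q, Disjoint G.nodes s.carried
  not_final : ∀ G ∈ q, ∀ d ∈ G.nodes, d ∉ s.final
  not_final_carried : ∀ d ∈ s.carried, d ∉ s.final
  ne_blank_iff : ∀ d, s.type d ≠ .blank ↔
    d ∈ s.final ∨ d ∈ s.carried ∨ ∃ G ∈ q, d ∈ G.nodes
  solid : ∀ G ∈ q, ∀ d ∈ G.nodes, n - f ≤ s.ap d G.round → s.type d = .solid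
  tournament : ∀ G ∈ s.finalized, G.IsTournament
  ordered : ∀ G ∈ s.finalized, ∀ d ∈ G.nodes, n - f ≤ s.ap d G.round →
    d ∈ s.final ∧ s.type d = .solid

omit [DecidableEq D] in
theorem inv_init (f : ℕ) : Inv f [] (FairState.init : FairState n D) := by
  constructor <;> simp [FairState.init]

namespace Inv

variable {f : ℕ} {q : List (Graph D)} {s : FairState n D}

/-- The two clauses on solid nodes survive since, by `hr`, every graph has a round below `r`, where
`ap` cannot rise. -/
theorem recordAll (h : Inv f q s) {r : ℕ} (hr : ∀ G ∈ s.finalized ++ q, G.round < r)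
    (A : List (Fin n × List (D × ℕ))) : Inv f q (s.recordAll r A) := by
  obtain ⟨h1, -, h3, h4, h5⟩ := recordAll_frame r A s
  constructor
  · rw [h5]; exact h.sorted
  · exact h.disjoint
  · rw [h3]; exact h.disjoint_carried
  · rw [h4]; exact h.not_final
  · rw [h3, h4]; exact h.not_final_carried
  · rw [h1, h3, h4]; exact h.ne_blank_iff
  · rw [h1]
    exact fun G hG d hd hap => h.solid G hG d hd
      (hap.trans (ap_recordAll_le (hr G (List.mem_append_right _ hG)) A s d))
  · rw [h5]; exact h.tournament
  · rw [h1, h4, h5]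
    exact fun G hG d hd hap => h.ordered G hG d hd
      (hap.trans (ap_recordAll_le (hr G (List.mem_append_left _ hG)) A s d))

omit [DecidableEq D] in
theorem map (h : Inv f q s) {g : Graph D → Graph D}
    (hg : ∀ G, (g G).round = G.round ∧ (g G).nodes = G.nodes) : Inv f (q.map g) s := by
  have h1 : Graph.round ∘ g = Graph.round := funext fun G => (hg G).1
  have h2 : Graph.nodes ∘ g = Graph.nodes := funext fun G => (hg G).2
  constructor
  · rw [List.map_map, h1]; exact h.sorted
  · rw [List.map_map, h2]; exact h.disjoint
  · simpa [hg] using h.disjoint_carried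
  · simpa [hg] using h.not_final
  · exact h.not_final_carried
  · simpa [hg] using h.ne_blank_iff
  · simpa [hg] using h.solid
  · exact h.tournament
  · exact h.ordered

/-- The nodes of the new graph were blank; by `ne_blank_iff` they are neither ordered nor carried
nor queued, which gives all disjointness clauses. -/
theorem pushGraph (h : Inv f q s) {r : ℕ} (hr : ∀ G ∈ s.finalized ++ q, G.round < r)
    (U : Finset D) :
    Inv f (q ++ [⟨r, U.filter fun d => s.type d = .blank ∧ s.classify f r d ≠ .blank, ∅⟩])
      (s.pushGraph f r U) := by
  set new := U.filter fun d => s.type d = .blank ∧ s.classify f r d ≠ .blank with hnew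
  have hblank : ∀ d ∈ new, s.type d = .blank := fun d hd => (Finset.mem_filter.1 hd).2.1
  have hfinal : ∀ d ∈ new, d ∉ s.final := fun d hd hd' =>
    (h.ne_blank_iff d).2 (Or.inl hd') (hblank d hd)
  have hcarried : ∀ d ∈ new, d ∉ s.carried := fun d hd hd' =>
    (h.ne_blank_iff d).2 (Or.inr (Or.inl hd')) (hblank d hd)
  have hqueue : ∀ d ∈ new, ∀ G ∈ q, d ∉ G.nodes := fun d hd G hG hd' =>
    (h.ne_blank_iff d).2 (Or.inr (Or.inr ⟨G, hG, hd'⟩)) (hblank d hd)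
  constructor
  · simp only [List.map_append, ← List.append_assoc, List.map_cons, List.map_nil]
    rw [List.pairwise_append]
    refine ⟨h.sorted, by simp, ?_⟩
    intro a ha b hb
    rw [List.mem_singleton.1 hb]
    change a ∈ s.finalized.map Graph.round ++ q.map Graph.round at ha
    rw [← List.map_append] at ha
    obtain ⟨G, hG, rfl⟩ := List.mem_map.1 ha
    exact hr G hG
  · rw [List.map_append, List.pairwise_append]
    refine ⟨h.disjoint, by simp, ?_⟩
    intro a ha b hb
    obtain ⟨G, hG, rfl⟩ := List.mem_map.1 ha
    rw [List.map_singleton, List.mem_singleton] at hb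
    subst hb
    exact Finset.disjoint_left.2 fun d hd hd' => hqueue d hd' G hG hd
  · intro G hG
    rcases List.mem_append.1 hG with hG | hG
    · exact h.disjoint_carried G hG
    · rw [List.mem_singleton.1 hG]
      exact Finset.disjoint_left.2 hcarried
  · intro G hG
    rcases List.mem_append.1 hG with hG | hG
    · exact h.not_final G hG
    · rw [List.mem_singleton.1 hG]
      exact hfinal
  · exact h.not_final_carried
  · intro d
    have : (s.pushGraph f r U).type d ≠ .blank ↔ s.type d ≠ .blank ∨ d ∈ new := by
      change (if d ∈ new then s.classify f r d else s.type d) ≠ .blank ↔ _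
      split_ifs with hd
      · exact iff_of_true (Finset.mem_filter.1 hd).2.2 (Or.inr hd)
      · simp [hd]
    rw [this, h.ne_blank_iff]
    simp only [List.mem_append, List.mem_singleton, or_and_right, exists_or, exists_eq_left,
      FairState.pushGraph, or_assoc]
  · intro G hG d hd hap
    change (if d ∈ new then s.classify f r d else s.type d) = .solid
    rcases List.mem_append.1 hG with hG | hG
    · rw [if_neg fun hd' => hqueue d hd' G hG hd]
      exact h.solid G hG d hd hap
    · rw [List.mem_singleton.1 hG] at hd hap
      rw [if_pos hd]
      exact classify_eq_solid hap
  · exact h.tournament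
  · intro G hG d hd hap
    obtain ⟨h1, h2⟩ := h.ordered G hG d hd hap
    refine ⟨h1, ?_⟩
    change (if d ∈ new then s.classify f r d else s.type d) = .solid
    rwa [if_neg fun hd' => hfinal d hd' h1]

theorem type_readdState_ne_blank_iff (h : Inv f q s) (G : Graph D) (d : D) :
    (s.readdState f G).type d ≠ .blank ↔ s.type d ≠ .blank := by
  change (if d ∈ s.carried then s.classify f G.round d else s.type d) ≠ .blank ↔ _
  split_ifs with hd
  · have := (h.ne_blank_iff d).2 (Or.inr (Or.inl hd))
    exact iff_of_true (classify_ne_blank_iff.2 (Or.inl this)) this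
  · rfl

/-- Reclassification touches carried nodes only, and these are disjoint from all queued graphs, so
the types of the other queued nodes do not change. -/
theorem readd {G : Graph D} (ch : Choices n D) (h : Inv f (G :: q) s) :
    Inv f (s.readdGraph f ch G :: q) (s.readdState f G) := by
  have hdis := h.disjoint
  rw [List.map_cons, List.pairwise_cons] at hdis
  have hcar : ∀ H ∈ q, Disjoint H.nodes s.carried :=
    fun H hH => h.disjoint_carried H (List.mem_cons_of_mem _ hH)
  have hnodes : (s.readdGraph f ch G).nodes = G.nodes ∪ s.carried := rfl
  constructor
  · exact h.sorted
  · rw [List.map_cons, List.pairwise_cons]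
    refine ⟨fun N hN => ?_, hdis.2⟩
    have h1 := hdis.1 N hN
    obtain ⟨H, hH, rfl⟩ := List.mem_map.1 hN
    rw [hnodes, Finset.disjoint_union_left]
    exact ⟨h1, (hcar H hH).symm⟩
  · exact fun _ _ => Finset.disjoint_empty_right _
  · rintro H hH d hd
    rcases List.mem_cons.1 hH with rfl | hH
    · rcases Finset.mem_union.1 hd with hd | hd
      · exact h.not_final G (by simp) d hd
      · exact h.not_final_carried d hd
    · exact h.not_final H (List.mem_cons_of_mem _ hH) d hd
  · exact fun d hd => absurd hd (Finset.notMem_empty d)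
  · intro d
    rw [h.type_readdState_ne_blank_iff, h.ne_blank_iff]
    simp only [List.mem_cons, or_and_right, exists_or, exists_eq_left, hnodes, Finset.mem_union,
      readdState, Finset.notMem_empty]
    tauto
  · intro H hH d hd hap
    change (if d ∈ s.carried then s.classify f G.round d else s.type d) = .solid
    rcases List.mem_cons.1 hH with rfl | hH
    · split_ifs with hc
      · exact classify_eq_solid hap
      · exact h.solid G (by simp) d ((Finset.mem_union.1 hd).resolve_right hc) hap
    · rw [if_neg (Finset.disjoint_left.1 (hcar H hH) hd)]
      exact h.solid H (List.mem_cons_of_mem _ hH) d hd hap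
  · exact h.tournament
  · intro H hH d hd hap
    obtain ⟨h1, h2⟩ := h.ordered H hH d hd hap
    refine ⟨h1, ?_⟩
    change (if d ∈ s.carried then s.classify f G.round d else s.type d) = .solid
    rwa [if_neg fun hd' => h.not_final_carried d hd' h1]

/-- The clause `ordered` for the removed graph comes from its clause `solid`: a solid node is never
in the carried suffix. The premise `hc` is needed because `order` overwrites the carried set. -/
theorem order {G : Graph D} (ch : Choices n D) (h : Inv f (G :: q) s) (hG : G.IsTournament)
    (hc : s.carried = ∅) : Inv f q (s.order ch G) := by
  have hdis := h.disjoint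
  rw [List.map_cons, List.pairwise_cons] at hdis
  have hsub := carried_order_subset ch s G
  have hdisG : ∀ H ∈ q, Disjoint G.nodes H.nodes :=
    fun H hH => hdis.1 _ (List.mem_map_of_mem hH)
  have hfin := mem_final_order ch s hG
  have htail : ∀ H ∈ q, H ∈ G :: q := fun H hH => List.mem_cons_of_mem _ hH
  constructor
  · have := h.sorted
    simpa [FairState.order] using this
  · exact hdis.2
  · exact fun H hH => ((hdisG H hH).mono_left hsub).symm
  · intro H hH d hd hd'
    rcases (hfin d).1 hd' with h' | h'
    · exact h.not_final H (htail H hH) d hd h'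
    · exact Finset.disjoint_left.1 (hdisG H hH) h'.1 hd
  · intro d hd hd'
    rcases (hfin d).1 hd' with h' | h'
    · exact h.not_final G (by simp) d (hsub hd) h'
    · exact h'.2 hd
  · intro d
    change s.type d ≠ .blank ↔ _
    rw [h.ne_blank_iff, hfin, hc]
    simp only [List.mem_cons, or_and_right, exists_or, exists_eq_left, Finset.notMem_empty]
    have := @hsub d
    tauto
  · exact fun H hH => h.solid H (htail H hH)
  · intro H hH
    rcases List.mem_append.1 hH with hH | hH
    · exact h.tournament H hH
    · rwa [List.mem_singleton.1 hH]
  · intro H hH d hd hap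
    rw [hfin]
    rcases List.mem_append.1 hH with hH | hH
    · exact (h.ordered H hH d hd hap).imp_left Or.inl
    · rw [List.mem_singleton.1 hH] at hd hap
      have hsol := h.solid G (by simp) d hd hap
      exact ⟨Or.inr ⟨hd, fun hd' => type_ne_solid_of_mem_carried_order ch s G hd' hsol⟩, hsol⟩

omit [DecidableEq D] in
theorem setGraphs (h : Inv f q s) (l : List (Graph D)) : Inv f q { s with graphs := l } :=
  ⟨h.1, h.2, h.3, h.4, h.5, h.6, h.7, h.8, h.9⟩

end Inv

theorem finalize_cons (f : ℕ) (ch : Choices n D) (G : Graph D) (q : List (Graph D))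
    (s : FairState n D) : finalize f ch (G :: q) s =
      if (s.readdGraph f ch G).IsTournament then
        finalize f ch q ((s.readdState f G).order ch (s.readdGraph f ch G))
      else { s.readdState f G with graphs := s.readdGraph f ch G :: q } := rfl

theorem Inv.finalize {f : ℕ} (ch : Choices n D) {q : List (Graph D)} {s : FairState n D}
    (h : Inv f q s) : Inv f (finalize f ch q s).graphs (finalize f ch q s) := by
  induction q generalizing s with
  | nil => exact h.setGraphs []
  | cons G q ih =>
    rw [finalize_cons]
    split_ifs with hT
    · exact ih ((h.readd ch).order ch hT rfl)
    · exact (h.readd ch).setGraphs _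

theorem Inv.type_finalize_ne_blank_iff {f : ℕ} (ch : Choices n D) {q : List (Graph D)}
    {s : FairState n D} (h : Inv f q s) (d : D) :
    (FairState.finalize f ch q s).type d ≠ .blank ↔ s.type d ≠ .blank := by
  induction q generalizing s with
  | nil => rfl
  | cons G q ih =>
    rw [finalize_cons]
    split_ifs with hT
    · exact (ih ((h.readd ch).order ch hT rfl)).trans (h.type_readdState_ne_blank_iff G d)
    · exact h.type_readdState_ne_blank_iff G d

theorem finalize_ois_rounds (f : ℕ) (ch : Choices n D) (q : List (Graph D)) (s : FairState n D) :
    (finalize f ch q s).ois = s.ois ∧ (finalize f ch q s).rounds = s.rounds := by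
  induction q generalizing s with
  | nil => exact ⟨rfl, rfl⟩
  | cons G q ih =>
    rw [finalize_cons]
    split_ifs with hT
    · exact ih _
    · exact ⟨rfl, rfl⟩

theorem graphs_or_carried_finalize (f : ℕ) (ch : Choices n D) (q : List (Graph D))
    (s : FairState n D) :
    (finalize f ch q s).graphs = [] ∨ (finalize f ch q s).carried = ∅ := by
  induction q generalizing s with
  | nil => exact Or.inl rfl
  | cons G q ih =>
    rw [finalize_cons]
    split_ifs with hT
    · exact ih _
    · exact Or.inr rfl

theorem final_subset_finalize (f : ℕ) (ch : Choices n D) (q : List (Graph D))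
    (s : FairState n D) : s.final ⊆ (finalize f ch q s).final := by
  induction q generalizing s with
  | nil => exact List.Subset.refl _
  | cons G q ih =>
    rw [finalize_cons]
    split_ifs with hT
    · exact fun d hd => ih _ (List.mem_append_left _ hd)
    · exact List.Subset.refl _

theorem finalized_subset_finalize (f : ℕ) (ch : Choices n D) (q : List (Graph D))
    (s : FairState n D) : s.finalized ⊆ (finalize f ch q s).finalized := by
  induction q generalizing s with
  | nil => exact List.Subset.refl _
  | cons G q ih =>
    rw [finalize_cons]
    split_ifs with hT
    · exact fun d hd => ih _ (List.mem_append_left _ hd)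
    · exact List.Subset.refl _

theorem extends_readdGraph (f : ℕ) (ch : Choices n D) (s : FairState n D) (G : Graph D) :
    G.Extends (s.readdGraph f ch G) :=
  ⟨rfl, Finset.subset_union_left, Finset.subset_union_left⟩

theorem extends_addEdges (f : ℕ) (ch : Choices n D) (s : FairState n D) (G : Graph D) :
    G.Extends (s.addEdges f ch G) :=
  ⟨rfl, subset_rfl, Finset.subset_union_left⟩

theorem exists_extends_finalize (f : ℕ) (ch : Choices n D) (q : List (Graph D))
    (s : FairState n D) : ∀ G ∈ q,
      ∃ H ∈ (finalize f ch q s).finalized ++ (finalize f ch q s).graphs, G.Extends H := by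
  induction q generalizing s with
  | nil => simp
  | cons G q ih =>
    rw [finalize_cons]
    intro H hH
    split_ifs with hT
    · rcases List.mem_cons.1 hH with rfl | hH
      · refine ⟨_, List.mem_append_left _ (finalized_subset_finalize f ch q _ ?_),
          extends_readdGraph f ch s H⟩
        exact List.mem_append_right _ (List.mem_singleton_self _)
      · exact ih _ H hH
    · rcases List.mem_cons.1 hH with rfl | hH
      · exact ⟨_, List.mem_append_right _ List.mem_cons_self, extends_readdGraph f ch s H⟩
      · exact ⟨H, List.mem_append_right _ (List.mem_cons_of_mem _ hH), .refl H⟩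

theorem round_of_mem_finalize (f : ℕ) (ch : Choices n D) (q : List (Graph D))
    (s : FairState n D) :
    ∀ G ∈ (finalize f ch q s).finalized ++ (finalize f ch q s).graphs,
      ∃ H ∈ s.finalized ++ q, H.round = G.round := by
  induction q generalizing s with
  | nil => exact fun G hG => ⟨G, hG, rfl⟩
  | cons G q ih =>
    rw [finalize_cons]
    intro H hH
    split_ifs at hH with hT
    · obtain ⟨K, hK, hr⟩ := ih _ H hH
      simp only [order, readdState, List.mem_append, List.mem_singleton] at hK
      rcases hK with (hK | rfl) | hK
      · exact ⟨K, by simp [hK], hr⟩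
      · exact ⟨G, by simp, hr⟩
      · exact ⟨K, by simp [hK], hr⟩
    · simp only [readdState, List.mem_append, List.mem_cons] at hH
      rcases hH with hH | rfl | hH
      · exact ⟨H, by simp [hH], rfl⟩
      · exact ⟨G, by simp, rfl⟩
      · exact ⟨H, by simp [hH], rfl⟩

theorem Inv.not_mem_of_mem_finalize {f : ℕ} (ch : Choices n D) {q : List (Graph D)}
    {s : FairState n D} (h : Inv f q s) {d : D} (hd : d ∈ s.final) :
    ∀ G ∈ (FairState.finalize f ch q s).finalized, G ∈ s.finalized ∨ d ∉ G.nodes := by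
  induction q generalizing s with
  | nil => exact fun G hG => Or.inl hG
  | cons G q ih =>
    rw [finalize_cons]
    split_ifs with hT
    · intro H hH
      rcases ih ((h.readd ch).order ch hT rfl) (List.mem_append_left _ hd) H hH with h' | h'
      · rcases List.mem_append.1 h' with h' | h'
        · exact Or.inl h'
        · rw [List.mem_singleton.1 h']
          exact Or.inr fun hd' => (h.readd ch).not_final _ (by simp) d hd' hd
      · exact Or.inr h'
    · exact fun H hH => Or.inl hH

theorem exists_carried_subset_finalize (f : ℕ) (ch : Choices n D) (G : Graph D)
    (q : List (Graph D)) (s : FairState n D) :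
    ∃ H ∈ (finalize f ch (G :: q) s).finalized ++ (finalize f ch (G :: q) s).graphs,
      H.round = G.round ∧ s.carried ⊆ H.nodes := by
  rw [finalize_cons]
  split_ifs with hT
  · refine ⟨s.readdGraph f ch G,
      List.mem_append_left _ (finalized_subset_finalize f ch q _ ?_), rfl,
      Finset.subset_union_right⟩
    exact List.mem_append_right _ (List.mem_singleton_self _)
  · exact ⟨s.readdGraph f ch G, List.mem_append_right _ List.mem_cons_self, rfl,
      Finset.subset_union_right⟩

/-- If the weights add up to `n - f`, the larger is at least half of it, so one direction is
preferred; for equal weights `tie_swap` makes the tie-break choose a direction. -/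
theorem isTournament_addEdges {f : ℕ} (ch : Choices n D) {s : FairState n D} {G : Graph D}
    (h : ∀ a ∈ G.nodes, ∀ b ∈ G.nodes, a ≠ b → n - f ≤ s.weight a b + s.weight b a) :
    (s.addEdges f ch G).IsTournament := by
  intro a ha b hb hab
  change a ∈ G.nodes at ha
  change b ∈ G.nodes at hb
  by_contra! hno
  have hw := h a ha b hb hab
  have hab' : (a, b) ∉ G.edges := fun he => hno.1 (Finset.mem_union_left _ he)
  have hba' : (b, a) ∉ G.edges := fun he => hno.2 (Finset.mem_union_left _ he)
  have h1 : ¬ s.Prefers f ch a b := fun hp => hno.1 (Finset.mem_union_right _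
    (Finset.mem_filter.2 ⟨Finset.mem_product.2 ⟨ha, hb⟩, hab, hab', hba', hp⟩))
  have h2 : ¬ s.Prefers f ch b a := fun hp => hno.2 (Finset.mem_union_right _
    (Finset.mem_filter.2 ⟨Finset.mem_product.2 ⟨hb, ha⟩, hab.symm, hba', hab', hp⟩))
  have ht := ch.tie_swap s a b hab
  unfold Prefers at h1 h2
  rcases lt_trichotomy (s.weight a b) (s.weight b a) with hlt | heq | hlt
  · exact h2 ⟨by omega, Or.inl hlt⟩
  · cases htie : ch.tie s a b
    · exact h2 ⟨by omega, Or.inr ⟨heq.symm, by rw [ht, htie]; rfl⟩⟩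
    · exact h1 ⟨by omega, Or.inr ⟨heq, htie⟩⟩
  · exact h1 ⟨by omega, Or.inl hlt⟩

end FairState
end FairDAG

/-! ### The effect of processing one subdag -/

namespace FairDAG
namespace FairState

variable {n : ℕ} {D : Type*} [DecidableEq D]
variable {f : ℕ} (ch : Choices n D) {r : ℕ} (A : List (Fin n × List (D × ℕ))) {s : FairState n D}

theorem onSubdag_eq (f : ℕ) (s : FairState n D) : s.onSubdag f ch r A =
    finalize f ch (((s.recordAll r A).pushGraph f r (s.updatedNodes A)).graphs.map
      (((s.recordAll r A).pushGraph f r (s.updatedNodes A)).addEdges f ch))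
      ((s.recordAll r A).pushGraph f r (s.updatedNodes A)) := rfl

theorem graphs_pushGraph (r f : ℕ) (s : FairState n D) (U : Finset D) :
    ((s.recordAll r A).pushGraph f r U).graphs = s.graphs ++
      [⟨r, U.filter fun d => (s.recordAll r A).type d = .blank ∧
        (s.recordAll r A).classify f r d ≠ .blank, ∅⟩] := by
  change (s.recordAll r A).graphs ++ _ = _
  rw [(recordAll_frame r A s).2.1]

theorem finalized_pushGraph (r f : ℕ) (s : FairState n D) (U : Finset D) :
    ((s.recordAll r A).pushGraph f r U).finalized = s.finalized :=
  (recordAll_frame r A s).2.2.2.2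

theorem final_pushGraph (r f : ℕ) (s : FairState n D) (U : Finset D) :
    ((s.recordAll r A).pushGraph f r U).final = s.final :=
  (recordAll_frame r A s).2.2.2.1

theorem carried_pushGraph (r f : ℕ) (s : FairState n D) (U : Finset D) :
    ((s.recordAll r A).pushGraph f r U).carried = s.carried :=
  (recordAll_frame r A s).2.2.1

theorem Inv.pushGraph_map_addEdges (h : Inv f s.graphs s)
    (hr : ∀ G ∈ s.finalized ++ s.graphs, G.round < r) (U : Finset D) :
    Inv f (((s.recordAll r A).pushGraph f r U).graphs.map
      (((s.recordAll r A).pushGraph f r U).addEdges f ch))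
      ((s.recordAll r A).pushGraph f r U) := by
  refine Inv.map ?_ fun G => ⟨rfl, rfl⟩
  rw [graphs_pushGraph]
  refine (h.recordAll hr A).pushGraph ?_ U
  rw [(recordAll_frame r A s).2.2.2.2]
  exact hr

theorem Inv.onSubdag (h : Inv f s.graphs s)
    (hr : ∀ G ∈ s.finalized ++ s.graphs, G.round < r) :
    Inv f (s.onSubdag f ch r A).graphs (s.onSubdag f ch r A) :=
  (h.pushGraph_map_addEdges ch A hr _).finalize ch

theorem rounds_onSubdag (r f : ℕ) (s : FairState n D) :
    (s.onSubdag f ch r A).rounds = (s.recordAll r A).rounds :=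
  (finalize_ois_rounds f ch _ _).2

theorem ois_onSubdag (r f : ℕ) (s : FairState n D) :
    (s.onSubdag f ch r A).ois = (s.recordAll r A).ois :=
  (finalize_ois_rounds f ch _ _).1

theorem graphs_or_carried_onSubdag (r f : ℕ) (s : FairState n D) :
    (s.onSubdag f ch r A).graphs = [] ∨ (s.onSubdag f ch r A).carried = ∅ :=
  graphs_or_carried_finalize f ch _ _

theorem final_subset_onSubdag (r f : ℕ) (s : FairState n D) :
    s.final ⊆ (s.onSubdag f ch r A).final := by
  have := final_subset_finalize f ch (((s.recordAll r A).pushGraph f r (s.updatedNodes A)).graphs.map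
      (((s.recordAll r A).pushGraph f r (s.updatedNodes A)).addEdges f ch))
      ((s.recordAll r A).pushGraph f r (s.updatedNodes A))
  rwa [final_pushGraph] at this

theorem finalized_subset_onSubdag (r f : ℕ) (s : FairState n D) :
    s.finalized ⊆ (s.onSubdag f ch r A).finalized := by
  have := finalized_subset_finalize f ch
      (((s.recordAll r A).pushGraph f r (s.updatedNodes A)).graphs.map
      (((s.recordAll r A).pushGraph f r (s.updatedNodes A)).addEdges f ch))
      ((s.recordAll r A).pushGraph f r (s.updatedNodes A))
  rwa [finalized_pushGraph] at this

theorem exists_extends_onSubdag (r f : ℕ) (s : FairState n D) :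
    ∀ G ∈ s.finalized ++ s.graphs,
      ∃ H ∈ (s.onSubdag f ch r A).finalized ++ (s.onSubdag f ch r A).graphs, G.Extends H := by
  intro G hG
  rcases List.mem_append.1 hG with hG | hG
  · exact ⟨G, List.mem_append_left _ (finalized_subset_onSubdag ch A r f s hG), .refl G⟩
  · have hm : G ∈ ((s.recordAll r A).pushGraph f r (s.updatedNodes A)).graphs := by
      rw [graphs_pushGraph]
      exact List.mem_append_left _ hG
    obtain ⟨H, hH, hGH⟩ := exists_extends_finalize f ch _ _ _ (List.mem_map_of_mem hm)
    exact ⟨H, hH, (extends_addEdges f ch _ G).trans hGH⟩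

theorem exists_round_onSubdag (r f : ℕ) (s : FairState n D) :
    ∃ H ∈ (s.onSubdag f ch r A).finalized ++ (s.onSubdag f ch r A).graphs, H.round = r := by
  obtain ⟨G, hG, hGr⟩ : ∃ G ∈ ((s.recordAll r A).pushGraph f r (s.updatedNodes A)).graphs,
      G.round = r := by
    rw [graphs_pushGraph]
    exact ⟨_, List.mem_append_right _ (List.mem_singleton_self _), rfl⟩
  obtain ⟨H, hH, hGH⟩ := exists_extends_finalize f ch _ _ _ (List.mem_map_of_mem hG)
  exact ⟨H, hH, hGH.1.trans hGr⟩

theorem round_of_mem_onSubdag (r f : ℕ) (s : FairState n D) :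
    ∀ G ∈ (s.onSubdag f ch r A).finalized ++ (s.onSubdag f ch r A).graphs,
      G.round = r ∨ ∃ H ∈ s.finalized ++ s.graphs, H.round = G.round := by
  intro G hG
  obtain ⟨H, hH, hHG⟩ := round_of_mem_finalize f ch _ _ G hG
  rw [finalized_pushGraph, graphs_pushGraph] at hH
  simp only [List.mem_append, List.mem_map, List.mem_singleton] at hH
  rcases hH with hH | ⟨K, hK | rfl, rfl⟩
  · exact Or.inr ⟨H, List.mem_append_left _ hH, hHG⟩
  · exact Or.inr ⟨K, List.mem_append_right _ hK, hHG⟩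
  · exact Or.inl hHG.symm

theorem exists_carried_subset_onSubdag (r f : ℕ) {s : FairState n D} (hs : s.graphs = []) :
    ∃ H ∈ (s.onSubdag f ch r A).finalized ++ (s.onSubdag f ch r A).graphs,
      H.round = r ∧ s.carried ⊆ H.nodes := by
  rw [onSubdag_eq, graphs_pushGraph, hs, List.nil_append, List.map_singleton]
  obtain ⟨H, hH, hr, hc⟩ := exists_carried_subset_finalize f ch _ []
    ((s.recordAll r A).pushGraph f r (s.updatedNodes A))
  rw [carried_pushGraph] at hc
  exact ⟨H, hH, hr, hc⟩

theorem Inv.not_mem_of_mem_onSubdag (h : Inv f s.graphs s)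
    (hr : ∀ G ∈ s.finalized ++ s.graphs, G.round < r) {d : D} (hd : d ∈ s.final) :
    ∀ G ∈ (s.onSubdag f ch r A).finalized, G ∈ s.finalized ∨ d ∉ G.nodes := by
  have := (h.pushGraph_map_addEdges ch A hr (s.updatedNodes A)).not_mem_of_mem_finalize ch (d := d)
    (by rwa [final_pushGraph])
  rwa [finalized_pushGraph] at this

/-- Only the push can end blankness: finalization reclassifies carried nodes, which are nonblank
already and stay so. -/
theorem Inv.type_onSubdag_ne_blank_iff (h : Inv f s.graphs s)
    (hr : ∀ G ∈ s.finalized ++ s.graphs, G.round < r) (d : D) :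
    (s.onSubdag f ch r A).type d ≠ .blank ↔ s.type d ≠ .blank ∨
      d ∈ s.updatedNodes A ∧ n - f ≤ 2 * (s.recordAll r A).ap d r := by
  rw [onSubdag_eq, (h.pushGraph_map_addEdges ch A hr _).type_finalize_ne_blank_iff ch d]
  change (if d ∈ (s.updatedNodes A).filter (fun d => (s.recordAll r A).type d = .blank ∧
    (s.recordAll r A).classify f r d ≠ .blank) then (s.recordAll r A).classify f r d
    else (s.recordAll r A).type d) ≠ .blank ↔ _
  have ht : (s.recordAll r A).type = s.type := (recordAll_frame r A s).1
  split_ifs with hd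
  · obtain ⟨h1, h2, h3⟩ := Finset.mem_filter.1 hd
    refine iff_of_true h3 ?_
    rw [classify_ne_blank_iff, ht] at h3
    exact h3.imp_right fun h' => ⟨h1, h'⟩
  · rw [ht]
    refine ⟨Or.inl, ?_⟩
    rintro (h' | h')
    · exact h'
    · intro hb
      exact hd (Finset.mem_filter.2 ⟨h'.1, by rw [ht, hb], classify_ne_blank_iff.2 (Or.inr h'.2)⟩)

theorem mem_updatedNodes_of_mem {A : List (Fin n × List (D × ℕ))} {d : D} (hd : d ∉ s.final)
    {v : Fin n × List (D × ℕ)} (hv : v ∈ A) {k : ℕ} (hk : (d, k) ∈ v.2) :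
    d ∈ s.updatedNodes A := by
  refine Finset.mem_filter.2 ⟨List.mem_toFinset.2 (List.mem_flatMap.2 ⟨v, hv, ?_⟩), hd⟩
  exact List.mem_map.2 ⟨_, hk, rfl⟩

/-- With nothing carried, the front graph gains no nodes. So it either leaves the queue, or stays
with the same nodes, in which case some pair must still lack weight, as otherwise
`isTournament_addEdges` would apply. -/
theorem head_onSubdag (r f : ℕ) {s : FairState n D} {H : Graph D} {q : List (Graph D)}
    (hs : s.graphs = H :: q) (hc : s.carried = ∅) :
    (∃ K ∈ (s.onSubdag f ch r A).finalized, K.round = H.round) ∨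
      (∃ K q', (s.onSubdag f ch r A).graphs = K :: q' ∧ K.round = H.round ∧ K.nodes = H.nodes) ∧
      ¬ ∀ a ∈ H.nodes, ∀ b ∈ H.nodes, a ≠ b →
        n - f ≤ (s.onSubdag f ch r A).weight a b + (s.onSubdag f ch r A).weight b a := by
  have hw : ∀ a b, (s.onSubdag f ch r A).weight a b = (s.recordAll r A).weight a b := by
    intro a b
    unfold weight
    rw [ois_onSubdag]
  simp only [hw]
  rw [onSubdag_eq, graphs_pushGraph, hs, List.cons_append, List.map_cons, finalize_cons]
  set s₂ := (s.recordAll r A).pushGraph f r (s.updatedNodes A) with hs₂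
  have hc₂ : s₂.carried = ∅ := by rw [hs₂, carried_pushGraph, hc]
  have hn : (s₂.readdGraph f ch (s₂.addEdges f ch H)).nodes = H.nodes := by
    change H.nodes ∪ s₂.carried = H.nodes
    rw [hc₂, Finset.union_empty]
  split_ifs with hT
  · refine Or.inl ⟨_, finalized_subset_finalize f ch _ _
      (List.mem_append_right _ (List.mem_singleton_self _)), rfl⟩
  · refine Or.inr ⟨⟨_, _, rfl, rfl, hn⟩, fun hready => hT ?_⟩
    refine isTournament_addEdges ch ?_
    change ∀ a ∈ H.nodes ∪ s₂.carried, ∀ b ∈ H.nodes ∪ s₂.carried, _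
    rw [hc₂, Finset.union_empty]
    exact hready

end FairState
end FairDAG

/-! ### Local orderings of correct replicas and their commitment -/

namespace FairDAG

theorem DAG.Valid.round_le_of_mem_history {n : ℕ} {D : Type*} {f : ℕ} {G : DAG n D}
    (hG : G.Valid f) {v w : VertexId n} (h : w ∈ G.history v) : w.2 ≤ v.2 := by
  change Relation.ReflTransGen G.Ref v w at h
  induction h with
  | refl => exact le_rfl
  | @tail b c _ hbc ih =>
    obtain ⟨x, hx, hs | hw⟩ := hbc
    · omega
    · have := ((hG b.1 b.2 x hx).2.2.2 c hw).1
      omega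

namespace Execution

variable {n : ℕ} {Txn D : Type*} [DecidableEq D] {P : Protocol n Txn D} {E : Execution n Txn D}

/-- At time `t`, replica `i` takes a transaction with digest `d` and gives it the indicator `k`. -/
def Takes (P : Protocol n Txn D) (E : Execution n Txn D) (i : Fin n) (d : D) (k t : ℕ) : Prop :=
  ∃ T, E.event i t = .receive T ∧ P.valid T = true ∧ P.digest T = d ∧
    d ∉ (E.state P i t).received ∧ k = (E.state P i t).counter + 1

theorem step_counter_le (s : ReplicaState n D) (G : DAG n D) (e : Event n Txn D) :
    s.counter ≤ (s.step P G e).counter ∧ s.received ⊆ (s.step P G e).received ∧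
      s.round ≤ (s.step P G e).round := by
  cases e with
  | receive T =>
    unfold ReplicaState.step
    dsimp only
    split_ifs
    · exact ⟨Nat.le_succ _, List.subset_append_left _ _, le_rfl⟩
    · exact ⟨le_rfl, List.Subset.refl _, le_rfl⟩
  | propose x => exact ⟨le_rfl, List.Subset.refl _, Nat.le_succ _⟩
  | idle => exact ⟨le_rfl, List.Subset.refl _, le_rfl⟩
  | commit L A => exact ⟨le_rfl, List.Subset.refl _, le_rfl⟩

theorem counter_mono (i : Fin n) {t t' : ℕ} (h : t ≤ t') :
    (E.state P i t).counter ≤ (E.state P i t').counter :=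
  monotone_nat_of_le_succ (f := fun t => (E.state P i t).counter)
    (fun _ => (step_counter_le _ _ _).1) h

theorem round_mono (i : Fin n) {t t' : ℕ} (h : t ≤ t') :
    (E.state P i t).round ≤ (E.state P i t').round :=
  monotone_nat_of_le_succ (f := fun t => (E.state P i t).round)
    (fun _ => (step_counter_le _ _ _).2.2) h

theorem received_mono (i : Fin n) {t t' : ℕ} (h : t ≤ t') :
    (E.state P i t).received ⊆ (E.state P i t').received := by
  induction t', h using Nat.le_induction with
  | base => exact List.Subset.refl _
  | succ t' _ ih => exact List.Subset.trans ih (step_counter_le _ _ _).2.1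

theorem state_succ_of_receive {i : Fin n} {t : ℕ} {T : Txn} (h : E.event i t = .receive T)
    (hT : P.valid T = true) (hd : P.digest T ∉ (E.state P i t).received) :
    E.state P i (t + 1) = { E.state P i t with
      counter := (E.state P i t).counter + 1
      received := (E.state P i t).received ++ [P.digest T]
      pending := (E.state P i t).pending ++ [(P.digest T, (E.state P i t).counter + 1)] } := by
  change (E.state P i t).step P E.dag (E.event i t) = _
  rw [h]
  exact if_pos ⟨hT, hd⟩

theorem Takes.succ {i : Fin n} {d : D} {k t : ℕ} (h : E.Takes P i d k t) :
    d ∈ (E.state P i (t + 1)).received ∧ (E.state P i (t + 1)).counter = k ∧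
      (d, k) ∈ (E.state P i (t + 1)).pending := by
  obtain ⟨T, hT, hv, rfl, hd, rfl⟩ := h
  rw [state_succ_of_receive hT hv hd]
  simp

/-- Each taking raises the counter, so an indicator is never used twice. -/
theorem Takes.digest_eq {i : Fin n} {d d' : D} {k t t' : ℕ} (h : E.Takes P i d k t)
    (h' : E.Takes P i d' k t') : d = d' := by
  wlog hle : t ≤ t' generalizing d d' t t'
  · exact (this h' h (le_of_not_ge hle)).symm
  rcases hle.eq_or_lt with rfl | hlt
  · obtain ⟨T, hT, -, rfl, -⟩ := h
    obtain ⟨T', hT', -, rfl, -⟩ := h'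
    rw [hT] at hT'
    rw [Event.receive.inj hT']
  · have h1 := h.succ.2.1
    have h2 := counter_mono (P := P) (E := E) i (Nat.succ_le_of_lt hlt)
    obtain ⟨-, -, -, -, -, hk⟩ := h'
    simp only [Nat.succ_eq_add_one] at h2
    omega

theorem exists_takes_of_mem_received {i : Fin n} {d : D} {t : ℕ}
    (h : d ∈ (E.state P i t).received) : ∃ k t', E.Takes P i d k t' := by
  induction t with
  | zero => exact absurd h (List.not_mem_nil)
  | succ t ih =>
    by_cases hd : d ∈ (E.state P i t).received
    · exact ih hd
    · change d ∈ ((E.state P i t).step P E.dag (E.event i t)).received at h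
      cases he : E.event i t with
      | receive T =>
        rw [he] at h
        unfold ReplicaState.step at h
        dsimp only at h
        split_ifs at h with hc
        · rcases List.mem_append.1 h with h | h
          · exact absurd h hd
          · obtain rfl := List.mem_singleton.1 h
            exact ⟨_, t, T, he, hc.1, rfl, hd, rfl⟩
        · exact absurd h hd
      | idle => rw [he] at h; exact absurd h hd
      | propose x => rw [he] at h; exact absurd h hd
      | commit L A => rw [he] at h; exact absurd h hd

theorem exists_takes_of_mem_pending {i : Fin n} {d : D} {k t : ℕ}
    (h : (d, k) ∈ (E.state P i t).pending) : ∃ t' < t, E.Takes P i d k t' := by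
  induction t with
  | zero => exact absurd h (List.not_mem_nil)
  | succ t ih =>
    have key : (d, k) ∈ (E.state P i t).pending → ∃ t' < t + 1, E.Takes P i d k t' := fun h =>
      let ⟨t', ht', h'⟩ := ih h
      ⟨t', ht'.trans (Nat.lt_succ_self t), h'⟩
    change (d, k) ∈ ((E.state P i t).step P E.dag (E.event i t)).pending at h
    cases he : E.event i t with
    | receive T =>
      rw [he] at h
      unfold ReplicaState.step at h
      dsimp only at h
      split_ifs at h with hc
      · rcases List.mem_append.1 h with h | h
        · exact key h
        · obtain ⟨rfl, rfl⟩ := Prod.mk.inj (List.mem_singleton.1 h)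
          exact ⟨t, Nat.lt_succ_self t, T, he, hc.1, rfl, hc.2, rfl⟩
      · exact key h
    | idle => rw [he] at h; exact key h
    | propose x => rw [he] at h; exact absurd h (List.not_mem_nil)
    | commit L A => rw [he] at h; exact key h

/-- Proposing clears the pending list, and a digest in `received` is never appended again. Hence a
correct replica puts each digest into at most one vertex. -/
theorem not_mem_pending_of_propose {i : Fin n} {d : D} {k t : ℕ} {x : Vertex n D}
    (hx : E.event i t = .propose x) (h : (d, k) ∈ (E.state P i t).pending) {t' : ℕ}
    (ht : t < t') (k' : ℕ) : (d, k') ∉ (E.state P i t').pending := by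
  intro hk'
  have hrec : d ∈ (E.state P i (t + 1)).received := by
    obtain ⟨u, hu, hT⟩ := exists_takes_of_mem_pending h
    exact received_mono i (by omega) hT.succ.1
  have hno : ∀ t', t + 1 ≤ t' → ∀ k', (d, k') ∉ (E.state P i t').pending := by
    intro t' ht'
    induction t', ht' using Nat.le_induction with
    | base =>
      change ∀ k', (d, k') ∉ ((E.state P i t).step P E.dag (E.event i t)).pending
      rw [hx]
      exact fun k' => List.not_mem_nil
    | succ t' ht' ih =>
      change ∀ k', (d, k') ∉ ((E.state P i t').step P E.dag (E.event i t')).pending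
      have hd := received_mono (P := P) (E := E) i ht' hrec
      cases he : E.event i t' with
      | receive T =>
        unfold ReplicaState.step
        dsimp only
        split_ifs with hc
        · intro k' hk'
          rcases List.mem_append.1 hk' with h | h
          · exact ih k' h
          · obtain ⟨rfl, -⟩ := Prod.mk.inj (List.mem_singleton.1 h)
            exact hc.2 hd
        · exact ih
      | idle => exact ih
      | propose x => exact fun k' => List.not_mem_nil
      | commit L A => exact ih
  exact hno t' ht k' hk'

theorem mem_leaders_iff {R : Fin n} {t : ℕ} {L : VertexId n} :
    L ∈ (E.state P R t).leaders ↔ ∃ t' < t, ∃ A, E.event R t' = .commit L A := by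
  induction t with
  | zero => exact iff_of_false List.not_mem_nil (by simp)
  | succ t ih =>
    have hlt : (∃ t' < t + 1, ∃ A, E.event R t' = .commit L A) ↔
        (∃ t' < t, ∃ A, E.event R t' = .commit L A) ∨ ∃ A, E.event R t = .commit L A := by
      constructor
      · rintro ⟨t', ht', h⟩
        rcases Nat.lt_succ_iff_lt_or_eq.1 ht' with h' | rfl
        · exact Or.inl ⟨t', h', h⟩
        · exact Or.inr h
      · rintro (⟨t', ht', h⟩ | h)
        · exact ⟨t', by omega, h⟩
        · exact ⟨t, by omega, h⟩
    rw [hlt, ← ih]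
    change L ∈ ((E.state P R t).step P E.dag (E.event R t)).leaders ↔ _
    cases he : E.event R t with
    | receive T =>
      unfold ReplicaState.step
      dsimp only
      split_ifs <;> simp
    | idle => simp [ReplicaState.step]
    | propose x => simp [ReplicaState.step]
    | commit L' A =>
      simp only [ReplicaState.step, List.mem_append, List.mem_singleton, Event.commit.injEq]
      refine or_congr_right ⟨fun h => ⟨A, h.symm, rfl⟩, fun ⟨_, h, _⟩ => h.symm⟩

theorem fair_succ_of_commit {R : Fin n} {t : ℕ} {L : VertexId n} {A : List (VertexId n)}
    (h : E.event R t = .commit L A) : E.fair P R (t + 1) =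
      (E.fair P R t).onSubdag P.f P.choices L.2 (A.map E.dag.slice) := by
  change ((E.state P R t).step P E.dag (E.event R t)).fair = _
  rw [h]
  rfl

theorem fair_succ_of_not_commit {R : Fin n} {t : ℕ}
    (h : ∀ L A, E.event R t ≠ .commit L A) : E.fair P R (t + 1) = E.fair P R t := by
  change ((E.state P R t).step P E.dag (E.event R t)).fair = _
  cases he : E.event R t with
  | receive T =>
    unfold ReplicaState.step
    dsimp only
    split_ifs <;> rfl
  | idle => rfl
  | propose x => rfl
  | commit L A => exact absurd he (h L A)

/-- A property of the fairness layer that each processing of a subdag preserves is stable. -/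
theorem fair_stable {R : Fin n} {p : FairState n D → Prop} {t t' : ℕ} (ht : t ≤ t')
    (hp : p (E.fair P R t))
    (step : ∀ u L A, t ≤ u → E.event R u = .commit L A → p (E.fair P R u) →
      p ((E.fair P R u).onSubdag P.f P.choices L.2 (A.map E.dag.slice))) :
    p (E.fair P R t') := by
  induction t', ht using Nat.le_induction with
  | base => exact hp
  | succ u hu ih =>
    by_cases h : ∃ L A, E.event R u = .commit L A
    · obtain ⟨L, A, h⟩ := h
      rw [fair_succ_of_commit h]
      exact step u L A hu h ih
    · push Not at h
      rwa [fair_succ_of_not_commit h]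

section Replica

variable (hE : E.Follows P)
include hE

theorem exists_propose_of_mem_pending {i : Fin n} (hi : i ∈ E.correct) {d : D} {k t : ℕ}
    (h : (d, k) ∈ (E.state P i t).pending) :
    ∃ t' ≥ t, ∃ x, E.event i t' = .propose x ∧ (d, k) ∈ (E.state P i t').pending := by
  classical
  -- The first proposal at or after `t` is taken, since up to it the pending list only grows.
  have hex : ∃ t', t ≤ t' ∧ ∃ x, E.event i t' = .propose x :=
    let ⟨t', h1, h2⟩ := hE.proposes i hi t
    ⟨t', h1, h2⟩
  have hmin : ∀ u, t ≤ u → u < Nat.find hex → ∀ x, E.event i u ≠ .propose x :=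
    fun u hu hlt x hx => Nat.find_min hex hlt ⟨hu, x, hx⟩
  obtain ⟨h1, x, h2⟩ := Nat.find_spec hex
  refine ⟨Nat.find hex, h1, x, h2, ?_⟩
  have key : ∀ u, t ≤ u → u ≤ Nat.find hex → (d, k) ∈ (E.state P i u).pending := by
    intro u hu
    induction u, hu using Nat.le_induction with
    | base => exact fun _ => h
    | succ u hu ih =>
      intro hle
      have ih := ih (by omega)
      change (d, k) ∈ ((E.state P i u).step P E.dag (E.event i u)).pending
      cases he : E.event i u with
      | receive T =>
        unfold ReplicaState.step
        dsimp only
        split_ifs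
        · exact List.mem_append_left _ ih
        · exact ih
      | idle => exact ih
      | propose x => exact absurd he (hmin u hu (by omega) x)
      | commit L A => exact ih
  exact key _ h1 le_rfl

theorem mem_pending_of_mem_entries {i : Fin n} (hi : i ∈ E.correct) {ρ : ℕ} {x : Vertex n D}
    (hx : E.dag (i, ρ) = some x) {e : D × ℕ} (he : e ∈ x.entries) :
    ∃ t, E.event i t = .propose x ∧ (E.state P i t).round = ρ ∧ e ∈ (E.state P i t).pending := by
  obtain ⟨t, ht, hr⟩ := hE.authentic i hi ρ x hx
  exact ⟨t, ht, hr, (hE.propose_eq i hi t x ht).1 ▸ he⟩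

theorem round_eq_of_mem_entries {i : Fin n} (hi : i ∈ E.correct) {ρ ρ' : ℕ} {x x' : Vertex n D}
    (hx : E.dag (i, ρ) = some x) (hx' : E.dag (i, ρ') = some x') {d : D} {k k' : ℕ}
    (hd : (d, k) ∈ x.entries) (hd' : (d, k') ∈ x'.entries) : ρ = ρ' := by
  obtain ⟨t, ht, hr, hp⟩ := mem_pending_of_mem_entries hE hi hx hd
  obtain ⟨t', ht', hr', hp'⟩ := mem_pending_of_mem_entries hE hi hx' hd'
  rcases lt_trichotomy t t' with h | rfl | h
  · exact absurd hp' (not_mem_pending_of_propose ht hp h _)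
  · rw [← hr, hr']
  · exact absurd hp (not_mem_pending_of_propose ht' hp' h _)

omit [DecidableEq D] hE in
theorem exists_entries_of_mem_slice {A : List (VertexId n)} {v : Fin n × List (D × ℕ)}
    (hv : v ∈ A.map E.dag.slice) {e : D × ℕ} (he : e ∈ v.2) :
    ∃ ρ x, (v.1, ρ) ∈ A ∧ E.dag (v.1, ρ) = some x ∧ e ∈ x.entries := by
  obtain ⟨⟨i, ρ⟩, hw, rfl⟩ := List.mem_map.1 hv
  cases hx : E.dag (i, ρ) with
  | none => simp [DAG.slice, hx] at he
  | some x => exact ⟨ρ, x, hw, hx, by simpa [DAG.slice, hx] using he⟩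

theorem exists_takes_of_mem_slice {A : List (VertexId n)} {v : Fin n × List (D × ℕ)}
    (hv : v ∈ A.map E.dag.slice) (hi : v.1 ∈ E.correct) {d : D} {k : ℕ} (hd : (d, k) ∈ v.2) :
    ∃ t, E.Takes P v.1 d k t := by
  obtain ⟨ρ, x, -, hx, he⟩ := exists_entries_of_mem_slice hv hd
  obtain ⟨t, -, -, hp⟩ := mem_pending_of_mem_entries hE hi hx he
  obtain ⟨t', -, h⟩ := exists_takes_of_mem_pending hp
  exact ⟨t', h⟩

omit hE in
theorem exists_takes_of_receive (hReceipt : E.EventualReceipt) {T : Txn}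
    (hT : P.valid T = true) {i : Fin n} (hi : i ∈ E.correct) {t : ℕ}
    (h : E.event i t = .receive T) {j : Fin n} (hj : j ∈ E.correct) :
    ∃ k t', E.Takes P j (P.digest T) k t' := by
  obtain ⟨t', ht'⟩ := hReceipt T i hi t h j hj
  by_cases hd : P.digest T ∈ (E.state P j t').received
  · exact exists_takes_of_mem_received hd
  · exact ⟨_, t', T, ht', hT, rfl, hd, rfl⟩

theorem exists_commit_of_takes (hValidity : E.Validity P) {i : Fin n} (hi : i ∈ E.correct)
    {d : D} {k t : ℕ} (h : E.Takes P i d k t) {R : Fin n} (hR : R ∈ E.correct) :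
    ∃ t' L A, E.event R t' = .commit L A ∧ ∃ v ∈ A.map E.dag.slice, v.1 = i ∧ (d, k) ∈ v.2 := by
  obtain ⟨u, -, x, hx, hp⟩ := exists_propose_of_mem_pending hE hi h.succ.2.2
  obtain ⟨t', L, A, hc, hA⟩ := hValidity i hi u x hx R hR
  obtain ⟨h1, h2⟩ := hE.propose_eq i hi u x hx
  refine ⟨t', L, A, hc, _, List.mem_map_of_mem hA, rfl, ?_⟩
  simpa [DAG.slice, h2, h1] using hp

theorem exists_round_le_propose {R : Fin n} (hR : R ∈ E.correct) (m : ℕ) :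
    ∃ t x, E.event R t = .propose x ∧ m ≤ (E.state P R t).round := by
  induction m with
  | zero =>
    obtain ⟨t, -, x, hx⟩ := hE.proposes R hR 0
    exact ⟨t, x, hx, Nat.zero_le _⟩
  | succ m ih =>
    obtain ⟨t, x, hx, hm⟩ := ih
    obtain ⟨t', ht', x', hx'⟩ := hE.proposes R hR (t + 1)
    refine ⟨t', x', hx', ?_⟩
    have h1 := round_mono (P := P) (E := E) R ht'
    have h2 : (E.state P R (t + 1)).round = (E.state P R t).round + 1 := by
      change ((E.state P R t).step P E.dag (E.event R t)).round = _
      rw [hx]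
      rfl
    omega

/-- References lead to lower rounds, so a subdag with a vertex of a high round has a leader of at
least that round. A round above all leaders committed before `t` also forces the commit to happen no
earlier than `t`. -/
theorem exists_commit_round_ge (hValidity : E.Validity P) {R : Fin n} (hR : R ∈ E.correct)
    (t m : ℕ) : ∃ t' ≥ t, ∃ L A, E.event R t' = .commit L A ∧ m ≤ L.2 := by
  let B := ((E.state P R t).leaders.map Prod.snd).toFinset.sup id
  obtain ⟨u, x, hx, hm⟩ := exists_round_le_propose hE hR (max m (B + 1))
  obtain ⟨t', L, A, hc, hA⟩ := hValidity R hR u x hx R hR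
  have hh := (((hE.commit_eq R hR t' L A hc).2.2.2 _).1 hA).1
  have hle := hE.dag_valid.round_le_of_mem_history hh
  dsimp only at hle
  refine ⟨t', ?_, L, A, hc, by omega⟩
  by_contra hlt
  have hL : L ∈ (E.state P R t).leaders := mem_leaders_iff.2 ⟨t', by omega, A, hc⟩
  have : L.2 ≤ B := Finset.le_sup (f := id) (List.mem_toFinset.2 (List.mem_map_of_mem hL))
  omega

/-- A digest from a correct replica occurs in at most one subdag. -/
theorem commit_time_unique {R : Fin n} (hR : R ∈ E.correct) {i : Fin n} (hi : i ∈ E.correct)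
    {d : D} {t t' : ℕ} {L L' : VertexId n} {A A' : List (VertexId n)}
    (h : E.event R t = .commit L A) (h' : E.event R t' = .commit L' A')
    (hd : ∃ v ∈ A.map E.dag.slice, v.1 = i ∧ ∃ k, (d, k) ∈ v.2)
    (hd' : ∃ v ∈ A'.map E.dag.slice, v.1 = i ∧ ∃ k, (d, k) ∈ v.2) : t = t' := by
  wlog hle : t ≤ t' generalizing t t' L L' A A'
  · exact (this h' h hd' hd (le_of_not_ge hle)).symm
  obtain ⟨v, hv, rfl, k, hk⟩ := hd
  obtain ⟨v', hv', hvi, k', hk'⟩ := hd'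
  obtain ⟨ρ, x, hA, hx, he⟩ := exists_entries_of_mem_slice hv hk
  obtain ⟨ρ', x', hA', hx', he'⟩ := exists_entries_of_mem_slice hv' hk'
  rw [hvi] at hx' hA'
  -- Both entries thus lie in one and the same vertex, and the history of the earlier leader is
  -- excluded from the later subdag.
  obtain rfl := round_eq_of_mem_entries hE hi hx hx' he he'
  rcases hle.eq_or_lt with rfl | hlt
  · rfl
  · have h1 := (((hE.commit_eq R hR t L A h).2.2.2 _).1 hA).1
    have h2 := (((hE.commit_eq R hR t' L' A' h').2.2.2 _).1 hA').2
    exact absurd h1 (h2 L (mem_leaders_iff.2 ⟨t, hlt, A, h⟩))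

end Replica

end Execution
end FairDAG

/-! ### Stability in time and the invariant along an execution -/

namespace FairDAG
namespace Execution

variable {n : ℕ} {Txn D : Type*} [DecidableEq D] {P : Protocol n Txn D} {E : Execution n Txn D}

section Stability

variable {R : Fin n} {t t' : ℕ}

theorem final_mono (ht : t ≤ t') : (E.fair P R t).final ⊆ (E.fair P R t').final :=
  fair_stable (p := fun s => (E.fair P R t).final ⊆ s.final) ht (List.Subset.refl _)
    fun _ _ _ _ _ h => List.Subset.trans h (FairState.final_subset_onSubdag _ _ _ _ _)

theorem finalized_mono (ht : t ≤ t') : (E.fair P R t).finalized ⊆ (E.fair P R t').finalized :=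
  fair_stable (p := fun s => (E.fair P R t).finalized ⊆ s.finalized) ht (List.Subset.refl _)
    fun _ _ _ _ _ h => List.Subset.trans h (FairState.finalized_subset_onSubdag _ _ _ _ _)

theorem exists_extends (ht : t ≤ t') {G : Graph D}
    (hG : G ∈ (E.fair P R t).finalized ++ (E.fair P R t).graphs) :
    ∃ H ∈ (E.fair P R t').finalized ++ (E.fair P R t').graphs, G.Extends H :=
  fair_stable (p := fun s => ∃ H ∈ s.finalized ++ s.graphs, G.Extends H) ht ⟨G, hG, .refl G⟩
    fun _ _ _ _ _ ⟨H, hH, hGH⟩ =>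
      let ⟨K, hK, hHK⟩ := FairState.exists_extends_onSubdag _ _ _ _ _ H hH
      ⟨K, hK, hGH.trans hHK⟩

end Stability

section Invariant

variable (hOrder : E.TotalAscendingOrder) {R : Fin n} (hR : R ∈ E.correct)
include hOrder hR

/-- The last clause traces each graph to an earlier commit. With the ascending order of leaders it
yields that the next round exceeds those of all existing graphs, which preservation of `Inv`
requires. -/
theorem inv_fair (t : ℕ) : FairState.Inv P.f (E.fair P R t).graphs (E.fair P R t) ∧
    ((E.fair P R t).graphs = [] ∨ (E.fair P R t).carried = ∅) ∧
    ∀ G ∈ (E.fair P R t).finalized ++ (E.fair P R t).graphs,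
      ∃ t' < t, ∃ L A, E.event R t' = .commit L A ∧ L.2 = G.round := by
  induction t with
  | zero =>
    exact ⟨FairState.inv_init P.f, Or.inl rfl, fun G hG => absurd hG List.not_mem_nil⟩
  | succ t ih =>
    obtain ⟨h1, h2, h3⟩ := ih
    by_cases h : ∃ L A, E.event R t = .commit L A
    · obtain ⟨L, A, h⟩ := h
      have hr : ∀ G ∈ (E.fair P R t).finalized ++ (E.fair P R t).graphs, G.round < L.2 := by
        intro G hG
        obtain ⟨t', ht', L', A', hc, hG'⟩ := h3 G hG
        exact hG' ▸ (hOrder R hR t' t L' A' L A ht' hc h).1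
      rw [fair_succ_of_commit h]
      refine ⟨h1.onSubdag _ _ hr, FairState.graphs_or_carried_onSubdag _ _ _ _ _, ?_⟩
      intro G hG
      rcases FairState.round_of_mem_onSubdag _ _ _ _ _ G hG with h' | ⟨H, hH, hHG⟩
      · exact ⟨t, Nat.lt_succ_self t, L, A, h, h'.symm⟩
      · obtain ⟨t', ht', L', A', hc, hH'⟩ := h3 H hH
        exact ⟨t', ht'.trans (Nat.lt_succ_self t), L', A', hc, hH'.trans hHG⟩
    · push Not at h
      rw [fair_succ_of_not_commit h]
      refine ⟨h1, h2, fun G hG => ?_⟩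
      obtain ⟨t', ht', h'⟩ := h3 G hG
      exact ⟨t', ht'.trans (Nat.lt_succ_self t), h'⟩

theorem round_lt_of_commit {t t' : ℕ} (ht : t ≤ t') {L : VertexId n} {A : List (VertexId n)}
    (h : E.event R t' = .commit L A) {G : Graph D}
    (hG : G ∈ (E.fair P R t).finalized ++ (E.fair P R t).graphs) : G.round < L.2 := by
  obtain ⟨u, hu, L', A', hc, hG'⟩ := (inv_fair hOrder hR t).2.2 G hG
  exact hG' ▸ (hOrder R hR u t' L' A' L A (hu.trans_le ht) hc h).1

theorem ne_blank_of_le {t t' : ℕ} (ht : t ≤ t') {d : D}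
    (h : (E.fair P R t).type d ≠ .blank) : (E.fair P R t').type d ≠ .blank :=
  fair_stable (p := fun s => s.type d ≠ .blank) ht h fun u _ _ _ hc h =>
    ((inv_fair hOrder hR u).1.type_onSubdag_ne_blank_iff _ _
      (fun _ hG => round_lt_of_commit hOrder hR le_rfl hc hG) d).2 (Or.inl h)

theorem round_lt_of_mem_finalized {t : ℕ} {G H : Graph D}
    (hG : G ∈ (E.fair P R t).finalized) (hH : H ∈ (E.fair P R t).graphs) : G.round < H.round :=
  (List.pairwise_append.1 (inv_fair hOrder hR t).1.sorted).2.2 _ (List.mem_map_of_mem hG) _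
    (List.mem_map_of_mem hH)

theorem eq_of_round_eq {t : ℕ} {G H : Graph D}
    (hG : G ∈ (E.fair P R t).finalized ++ (E.fair P R t).graphs)
    (hH : H ∈ (E.fair P R t).finalized ++ (E.fair P R t).graphs)
    (h : G.round = H.round) : G = H := by
  have hs := (inv_fair (P := P) hOrder hR t).1.sorted
  rw [← List.map_append] at hs
  exact List.inj_on_of_nodup_map (hs.imp fun h => ne_of_lt h) hG hH h

end Invariant

/-! ### Liveness -/

section Liveness

variable (hn : 2 * P.f < n - P.f) (hE : E.Follows P) (hOrder : E.TotalAscendingOrder)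
  (hValidity : E.Validity P) (hReceipt : E.EventualReceipt) {R : Fin n} (hR : R ∈ E.correct)

include hE

theorem card_correct_ge : n - P.f ≤ E.correct.card := by
  have h1 := hE.byzantine
  have h2 := Finset.card_add_card_compl E.correct
  rw [Fintype.card_fin] at h2
  omega

theorem ap_ge_of_rounds_le {s : FairState n D} {d : D} {ρ : ℕ}
    (h : ∀ j ∈ E.correct, s.rounds d j ≤ (ρ : ℕ∞)) : n - P.f ≤ s.ap d ρ :=
  (card_correct_ge hE).trans (Finset.card_le_card fun j hj => by simpa using h j hj)

/-- By authenticity, an indicator recorded from a correct replica is one that it really assigned. -/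
theorem exists_takes_of_rounds_ne_top {i : Fin n} (hi : i ∈ E.correct) {d : D} {t : ℕ}
    (h : (E.fair P R t).rounds d i ≠ ⊤) :
    ∃ k t', (E.fair P R t).ois d i = (k : ℕ) ∧ E.Takes P i d k t' := by
  refine fair_stable (p := fun s => s.rounds d i ≠ ⊤ → ∃ k t', s.ois d i = ((k : ℕ) : ℕ∞) ∧
    E.Takes P i d k t') (Nat.zero_le t) (fun h => absurd rfl h) (fun u L A _ _ ih => ?_) h
  rw [FairState.rounds_onSubdag, FairState.ois_onSubdag]
  rcases FairState.rounds_recordAll_cases L.2 (A.map E.dag.slice) (E.fair P R u) d i with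
    ⟨h1, h2⟩ | ⟨-, k, h2, v, hv, rfl, hk⟩
  · rwa [h1, h2]
  · intro _
    obtain ⟨t', ht'⟩ := exists_takes_of_mem_slice hE hv hi hk
    exact ⟨k, t', h2, ht'⟩

theorem weight_add_weight_ge {a b : D} (hab : a ≠ b) {t : ℕ}
    (ha : ∀ j ∈ E.correct, (E.fair P R t).rounds a j ≠ ⊤)
    (hb : ∀ j ∈ E.correct, (E.fair P R t).rounds b j ≠ ⊤) :
    n - P.f ≤ (E.fair P R t).weight a b + (E.fair P R t).weight b a := by
  refine (card_correct_ge hE).trans (le_trans (Finset.card_le_card fun j hj => ?_)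
    (Finset.card_union_le _ _))
  obtain ⟨k, u, hk, hu⟩ := exists_takes_of_rounds_ne_top hE hj (ha j hj)
  obtain ⟨k', u', hk', hu'⟩ := exists_takes_of_rounds_ne_top hE hj (hb j hj)
  have hne : k ≠ k' := fun h => hab (hu.digest_eq (h ▸ hu'))
  simp only [Finset.mem_union, Finset.mem_filter, Finset.mem_univ, true_and, hk, hk', Nat.cast_lt]
  omega

include hValidity hR in
-- The entry is recorded unless `d` is already ordered, and the record persists because no other
-- subdag contains `d` from `i`.
theorem exists_rounds_eq_of_takes {i : Fin n} (hi : i ∈ E.correct) {d : D} {k t₀ : ℕ}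
    (h : E.Takes P i d k t₀) : ∃ t L A, E.event R t = .commit L A ∧
      (∃ v ∈ A.map E.dag.slice, v.1 = i ∧ ∃ k, (d, k) ∈ v.2) ∧
      (d ∉ (E.fair P R t).final → ∀ t' > t, (E.fair P R t').rounds d i = (L.2 : ℕ∞)) := by
  obtain ⟨t, L, A, hc, v, hv, hvi, hk⟩ := exists_commit_of_takes hE hValidity hi h hR
  refine ⟨t, L, A, hc, ⟨v, hv, hvi, k, hk⟩, fun hd t' ht' => ?_⟩
  refine fair_stable (p := fun s => s.rounds d i = (L.2 : ℕ∞)) (Nat.succ_le_of_lt ht') ?_ ?_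
  · change (E.fair P R (t + 1)).rounds d i = _
    rw [fair_succ_of_commit hc, FairState.rounds_onSubdag]
    exact FairState.rounds_recordAll_of_mem hd hv hvi hk
  · intro u L' A' hu hc' ih
    rw [FairState.rounds_onSubdag]
    rcases FairState.rounds_recordAll_cases L'.2 (A'.map E.dag.slice) (E.fair P R u) d i with
      ⟨h1, -⟩ | ⟨-, k', -, w, hw, hwi, hk'⟩
    · rwa [h1]
    · have := commit_time_unique hE hR hi hc hc' ⟨v, hv, hvi, k, hk⟩ ⟨w, hw, hwi, k', hk'⟩
      omega

include hOrder hValidity hR in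
/-- The last subdag that contains `d` from a correct replica completes the correct indicators. -/
theorem exists_commit_forall_rounds_le {d : D}
    (h : ∀ j ∈ E.correct, ∃ k t, E.Takes P j d k t) :
    ∃ u L A, E.event R u = .commit L A ∧ (∃ v ∈ A.map E.dag.slice, ∃ k, (d, k) ∈ v.2) ∧
      (d ∉ (E.fair P R u).final → ∀ t > u, ∀ j ∈ E.correct,
        (E.fair P R t).rounds d j ≤ (L.2 : ℕ∞)) := by
  have hex : ∀ j : Fin n, ∃ (u : ℕ) (L : VertexId n) (A : List (VertexId n)), j ∈ E.correct →
      E.event R u = .commit L A ∧ (∃ v ∈ A.map E.dag.slice, v.1 = j ∧ ∃ k, (d, k) ∈ v.2) ∧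
      (d ∉ (E.fair P R u).final → ∀ t' > u, (E.fair P R t').rounds d j = (L.2 : ℕ∞)) := by
    intro j
    by_cases hj : j ∈ E.correct
    · obtain ⟨k, t', ht'⟩ := h j hj
      obtain ⟨u, L, A, hu⟩ := exists_rounds_eq_of_takes hE hValidity hR hj ht'
      exact ⟨u, L, A, fun _ => hu⟩
    -- Dummy values for Byzantine indices, so that `choose` yields total functions.
    · exact ⟨0, (R, 0), [], fun hj' => absurd hj' hj⟩
  choose u L A hu using hex
  obtain ⟨j, hj, hmax⟩ := Finset.exists_max_image E.correct u ⟨R, hR⟩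
  obtain ⟨hc, ⟨v, hv, -, k, hk⟩, -⟩ := hu j hj
  refine ⟨u j, L j, A j, hc, ⟨v, hv, k, hk⟩, fun hd t ht i hi => ?_⟩
  have hle := hmax i hi
  rw [(hu i hi).2.2 (fun hd' => hd (final_mono hle hd')) t (by omega), Nat.cast_le]
  rcases hle.eq_or_lt with heq | hlt
  · have hc' := (hu i hi).1
    rw [heq, hc] at hc'
    rw [(Event.commit.inj hc').1]
  · exact (hOrder R hR _ _ _ _ _ _ hlt (hu i hi).1 hc).1.le

include hn hOrder hReceipt hR in
-- A nonblank node once had at least `(n - f) / 2 > f` indicators, one of them from a correct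
-- replica. So the digest belongs to a valid transaction, which reaches every correct replica. This
-- is where the fault bound is used.
theorem exists_takes_of_ne_blank {t : ℕ} {d : D} (h : (E.fair P R t).type d ≠ .blank) :
    ∀ j ∈ E.correct, ∃ k t', E.Takes P j d k t' := by
  have key : ∃ i ∈ E.correct, (E.fair P R t).rounds d i ≠ ⊤ := by
    refine fair_stable (p := fun s => s.type d ≠ .blank → ∃ i ∈ E.correct, s.rounds d i ≠ ⊤)
      (Nat.zero_le t) (fun h => absurd rfl h) (fun u L A _ hc ih h => ?_) h
    rw [(inv_fair hOrder hR u).1.type_onSubdag_ne_blank_iff _ _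
      (fun _ hG => round_lt_of_commit hOrder hR le_rfl hc hG)] at h
    rw [FairState.rounds_onSubdag]
    rcases h with h | ⟨-, h⟩
    · obtain ⟨i, hi, hne⟩ := ih h
      refine ⟨i, hi, ?_⟩
      rcases FairState.rounds_recordAll_cases L.2 (A.map E.dag.slice) (E.fair P R u) d i with
        h' | h'
      · rwa [h'.1]
      · rw [h'.1]; exact ENat.natCast_ne_top _
    · have hlt : (E.correctᶜ).card <
          ((E.fair P R u).recordAll L.2 (A.map E.dag.slice)).ap d L.2 := by
        have := hE.byzantine
        omega
      obtain ⟨i, hi, hi'⟩ := Finset.exists_mem_notMem_of_card_lt_card hlt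
      refine ⟨i, by simpa using hi', ?_⟩
      exact ne_top_of_le_ne_top (ENat.natCast_ne_top _) (Finset.mem_filter.1 hi).2
  obtain ⟨i, hi, hne⟩ := key
  obtain ⟨k, t', -, T, hT, hv, rfl, -⟩ := exists_takes_of_rounds_ne_top hE hi hne
  exact fun j hj => exists_takes_of_receive hReceipt hv hi hT hj

include hn hOrder hValidity hReceipt hR

theorem exists_finalized_of_head {t : ℕ} {H : Graph D} {q : List (Graph D)}
    (h : (E.fair P R t).graphs = H :: q) :
    ∃ t' ≥ t, ∃ K ∈ (E.fair P R t').finalized, K.round = H.round := by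
  by_contra! hno
  have hcarried : ∀ {t' K q'}, (E.fair P R t').graphs = K :: q' → (E.fair P R t').carried = ∅ :=
    fun hq => (inv_fair hOrder hR _).2.1.resolve_left (by rw [hq]; exact List.cons_ne_nil _ _)
  have hhead : ∀ t' ≥ t, ∃ K q', (E.fair P R t').graphs = K :: q' ∧ K.round = H.round ∧
      K.nodes = H.nodes := by
    intro t' ht'
    induction t', ht' using Nat.le_induction with
    | base => exact ⟨H, q, h, rfl, rfl⟩
    | succ u hu ih =>
      obtain ⟨K, q', hq', hr, hnod⟩ := ih
      by_cases hc : ∃ L A, E.event R u = .commit L A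
      · obtain ⟨L, A, hc⟩ := hc
        have hno' := hno (u + 1) (by omega)
        rw [fair_succ_of_commit hc] at hno' ⊢
        rcases FairState.head_onSubdag P.choices (A.map E.dag.slice) L.2 P.f hq' (hcarried hq') with
          ⟨K', hK', hr'⟩ | ⟨⟨K', q'', h1, h2, h3⟩, -⟩
        · exact absurd (hr'.trans hr) (hno' K' hK')
        · exact ⟨K', q'', h1, h2.trans hr, h3.trans hnod⟩
      · push Not at hc
        rw [fair_succ_of_not_commit hc]
        exact ⟨K, q', hq', hr, hnod⟩
  have hrec : ∀ d, ∃ T, d ∈ H.nodes → ∀ t' ≥ T, t ≤ t' → ∀ j ∈ E.correct,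
      (E.fair P R t').rounds d j ≠ ⊤ := by
    intro d
    by_cases hd : d ∈ H.nodes
    · have hne : (E.fair P R t).type d ≠ .blank := ((inv_fair hOrder hR t).1.ne_blank_iff d).2
        (Or.inr (Or.inr ⟨H, by rw [h]; exact List.mem_cons_self, hd⟩))
      obtain ⟨T, L, A, -, -, hT⟩ := exists_commit_forall_rounds_le hE hOrder hValidity hR
        (exists_takes_of_ne_blank hn hE hOrder hReceipt hR hne)
      refine ⟨T + 1, fun _ t' ht' htt' j hj => ?_⟩
      obtain ⟨K, q', hq', -, hnod⟩ := hhead t' htt'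
      -- A queued node is not ordered yet, so its correct indicators have not been ignored.
      have hnf := (inv_fair (P := P) hOrder hR t').1.not_final K
        (by rw [hq']; exact List.mem_cons_self) d (by rwa [hnod])
      exact ne_top_of_le_ne_top (ENat.natCast_ne_top _) (hT (fun hd' => hnf (final_mono
        (Nat.le_of_succ_le ht') hd')) t' ht' j hj)
    · exact ⟨0, fun hd' => absurd hd' hd⟩
  choose T hT using hrec
  -- Edges are only added when a subdag is processed, so one more commit is needed after the last
  -- indicator of the finitely many nodes has arrived.
  obtain ⟨u, hu, L, A, hc, -⟩ := exists_commit_round_ge hE hValidity hR (max t (H.nodes.sup T)) 0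
  obtain ⟨K, q', hq', hr, hnod⟩ := hhead u (by omega)
  have hno' := hno (u + 1) (by omega)
  have hready : ∀ d ∈ H.nodes, ∀ j ∈ E.correct, (E.fair P R (u + 1)).rounds d j ≠ ⊤ := by
    intro d hd
    have : T d ≤ H.nodes.sup T := Finset.le_sup hd
    exact hT d hd (u + 1) (by omega) (by omega)
  have hw : ∀ a ∈ K.nodes, ∀ b ∈ K.nodes, a ≠ b →
      n - P.f ≤ (E.fair P R (u + 1)).weight a b + (E.fair P R (u + 1)).weight b a := by
    rw [hnod]
    exact fun a ha b hb hab => weight_add_weight_ge hE hab (hready a ha) (hready b hb)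
  rw [fair_succ_of_commit hc] at hno' hw
  rcases FairState.head_onSubdag P.choices (A.map E.dag.slice) L.2 P.f hq' (hcarried hq') with
    ⟨K', hK', hr'⟩ | ⟨-, h'⟩
  · exact hno' K' hK' (hr'.trans hr)
  · exact h' hw

/-- Eventually no graph of a round below `r` is in the queue. -/
theorem exists_forall_le_round (r : ℕ) :
    ∃ T, ∀ t ≥ T, ∀ G ∈ (E.fair P R t).graphs, r ≤ G.round := by
  induction r with
  | zero => exact ⟨0, fun _ _ _ _ => Nat.zero_le _⟩
  | succ r ih =>
    obtain ⟨T, hT⟩ := ih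
    by_cases h : ∀ t ≥ T, ∀ G ∈ (E.fair P R t).graphs, G.round ≠ r
    · exact ⟨T, fun t ht G hG => lt_of_le_of_ne (hT t ht G hG) (h t ht G hG).symm⟩
    · push Not at h
      obtain ⟨t, ht, G, hG, hr⟩ := h
      obtain ⟨H, q, hq⟩ := List.exists_cons_of_ne_nil (List.ne_nil_of_mem hG)
      -- Rounds increase along the queue and are at least `r` by now, so the graph of round `r` is
      -- at the front.
      have hHr : H.round = r := by
        refine le_antisymm ?_ (hT t ht H (by rw [hq]; exact List.mem_cons_self))
        have hs := (List.pairwise_append.1 (inv_fair (P := P) hOrder hR t).1.sorted).2.1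
        rw [hq, List.map_cons, List.pairwise_cons] at hs
        rw [hq] at hG
        rcases List.mem_cons.1 hG with rfl | hG
        · exact hr.le
        · exact hr ▸ (hs.1 _ (List.mem_map_of_mem hG)).le
      obtain ⟨t', ht', K, hK, hKr⟩ :=
        exists_finalized_of_head hn hE hOrder hValidity hReceipt hR hq
      refine ⟨t', fun u hu G' hG' => ?_⟩
      have := round_lt_of_mem_finalized hOrder hR (finalized_mono hu hK) hG'
      omega

theorem exists_finalized_extends {t : ℕ} {G : Graph D}
    (hG : G ∈ (E.fair P R t).finalized ++ (E.fair P R t).graphs) :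
    ∃ t' ≥ t, ∃ H ∈ (E.fair P R t').finalized, G.Extends H := by
  obtain ⟨T, hT⟩ := exists_forall_le_round hn hE hOrder hValidity hReceipt hR (G.round + 1)
  obtain ⟨H, hH, hGH⟩ := exists_extends (le_max_left t T) hG
  refine ⟨max t T, le_max_left _ _, H, (List.mem_append.1 hH).resolve_right fun hH' => ?_, hGH⟩
  have h1 := hT _ (le_max_right _ _) H hH'
  have h2 := hGH.1
  omega

/-- Every dependency graph leaves the queue as a tournament that extends all its earlier forms. -/
theorem exists_finalized_tournament {t : ℕ} {L : VertexId n} {A : List (VertexId n)}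
    (h : E.event R t = .commit L A) :
    ∃ t', ∃ G ∈ (E.fair P R t').finalized, G.round = L.2 ∧ G.IsTournament ∧
      ∀ u, ∀ H ∈ (E.fair P R u).graphs, H.round = L.2 →
        H.nodes ⊆ G.nodes ∧ H.edges ⊆ G.edges := by
  obtain ⟨K, hK, hr⟩ :=
    FairState.exists_round_onSubdag P.choices (A.map E.dag.slice) L.2 P.f (E.fair P R t)
  rw [← fair_succ_of_commit h] at hK
  obtain ⟨t', -, G, hG, hKG⟩ := exists_finalized_extends hn hE hOrder hValidity hReceipt hR hK
  have hGr : G.round = L.2 := hKG.1.trans hr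
  refine ⟨t', G, hG, hGr, (inv_fair hOrder hR t').1.tournament G hG, fun u H hH hHr => ?_⟩
  -- A form of the graph seen before `t'` evolves into a graph present at `t'`, which is `G` because
  -- rounds are unique; after `t'` only higher rounds are queued.
  rcases le_total u t' with hu | hu
  · obtain ⟨H', hH', hHH'⟩ := exists_extends hu (List.mem_append_right _ hH)
    obtain rfl := eq_of_round_eq hOrder hR hH' (List.mem_append_left _ hG)
      (hHH'.1.trans (hHr.trans hGr.symm))
    exact hHH'.2
  · have := round_lt_of_mem_finalized hOrder hR (finalized_mono hu hG) hH
    omega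

theorem exists_mem_final_of_ne_blank {t : ℕ} {d : D} (h : (E.fair P R t).type d ≠ .blank) :
    ∃ t', d ∈ (E.fair P R t').final := by
  by_contra! hno
  obtain ⟨T, ⟨_, ρ⟩, -, -, -, hT⟩ := exists_commit_forall_rounds_le hE hOrder hValidity hR
    (exists_takes_of_ne_blank hn hE hOrder hReceipt hR h)
  replace hT := hT (hno T)
  -- A graph of round at least `ρ` that contains `d` would be removed at some time with `ap ≥ n -
  -- f`, and `d` would be ordered.
  have hlow : ∀ t₁, ∀ G ∈ (E.fair P R t₁).finalized ++ (E.fair P R t₁).graphs, d ∈ G.nodes →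
      G.round < ρ := by
    intro t₁ G hG hd
    by_contra hle
    obtain ⟨t₂, -, H, hH, hGH⟩ := exists_finalized_extends hn hE hOrder hValidity hReceipt hR hG
    refine hno (max t₂ (T + 1)) ((inv_fair hOrder hR _).1.ordered H (finalized_mono
      (le_max_left _ _) hH) d (hGH.2.1 hd) (ap_ge_of_rounds_le hE fun j hj => ?_)).1
    refine (hT _ (Nat.lt_of_succ_le (le_max_right _ _)) j hj).trans ?_
    rw [Nat.cast_le, hGH.1]
    omega
  obtain ⟨T', hT'⟩ := exists_forall_le_round hn hE hOrder hValidity hReceipt hR ρ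
  obtain ⟨u, hu, L, A, hc, hL⟩ := exists_commit_round_ge hE hValidity hR (max t T') ρ
  obtain ⟨hinv, hrest, -⟩ := inv_fair (P := P) hOrder hR u
  have hcar : d ∈ (E.fair P R u).carried := by
    rcases (hinv.ne_blank_iff d).1 (ne_blank_of_le hOrder hR (by omega) h) with h' | h' | h'
    · exact absurd h' (hno u)
    · exact h'
    · obtain ⟨G, hG, hd⟩ := h'
      have h1 := hlow u G (List.mem_append_right _ hG) hd
      have h2 := hT' u (by omega) G hG
      omega
  have hq : (E.fair P R u).graphs = [] :=
    hrest.resolve_right fun he => Finset.notMem_empty d (he ▸ hcar)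
  obtain ⟨H, hH, hr, hsub⟩ :=
    FairState.exists_carried_subset_onSubdag P.choices (A.map E.dag.slice) L.2 P.f hq
  rw [← fair_succ_of_commit hc] at hH
  have := hlow _ H hH (hsub hcar)
  omega

omit hn hReceipt in
/-- Once a digest is ordered, it is in no dependency graph of a later round. -/
theorem exists_commit_forall_not_mem_nodes {t : ℕ} {d : D} (h : d ∈ (E.fair P R t).final) :
    ∃ u L A, E.event R u = .commit L A ∧
      ∀ t', ∀ G ∈ (E.fair P R t').graphs ++ (E.fair P R t').finalized,
        L.2 ≤ G.round → d ∉ G.nodes := by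
  obtain ⟨u, hu, L, A, hc, -⟩ := exists_commit_round_ge hE hValidity hR t 0
  refine ⟨u, L, A, hc, fun t' G hG hLG hd => ?_⟩
  rcases le_total t' t with ht | ht
  · obtain ⟨H, hH, hGH⟩ := exists_extends ht (List.mem_append.2 (List.mem_append.1 hG).symm)
    have h1 := round_lt_of_commit hOrder hR hu hc hH
    have h2 := hGH.1
    omega
  · rcases List.mem_append.1 hG with hG | hG
    · exact (inv_fair hOrder hR t').1.not_final G hG d hd (final_mono ht h)
    -- Graphs finalized by time `t` have rounds below that of the later leader `L`, and graphs
    -- finalized afterwards cannot contain the ordered digest `d`.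
    · have hfin := fair_stable (p := fun s => d ∈ s.final ∧ ∀ G ∈ s.finalized, d ∈ G.nodes →
          G.round < L.2) ht
        ⟨h, fun G hG _ => round_lt_of_commit hOrder hR hu hc (List.mem_append_left _ hG)⟩
        fun v L' A' _ hc' ih => ⟨FairState.final_subset_onSubdag _ _ _ _ _ ih.1, fun G hG hd =>
          ih.2 G (((inv_fair hOrder hR v).1.not_mem_of_mem_onSubdag _ _
            (fun _ hG => round_lt_of_commit hOrder hR le_rfl hc' hG) ih.1 G hG).resolve_right
              (not_not_intro hd)) hd⟩
      exact absurd (hfin.2 G hG hd) (not_lt.2 hLG)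

/-- From some committed round on, the node of `d` is solid in each graph that contains it. -/
theorem exists_commit_forall_solid {t : ℕ} {d : D} (h : (E.fair P R t).type d ≠ .blank) :
    ∃ u L A, E.event R u = .commit L A ∧
      ∀ t', ∀ G ∈ (E.fair P R t').graphs ++ (E.fair P R t').finalized,
        L.2 ≤ G.round → d ∈ G.nodes → (E.fair P R t').type d = .solid := by
  obtain ⟨u, L, A, hc, -, hu⟩ := exists_commit_forall_rounds_le hE hOrder hValidity hR
    (exists_takes_of_ne_blank hn hE hOrder hReceipt hR h)
  -- If `d` is ordered before its last correct indicator is committed, that indicator is ignored and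
  -- `ap` may stay below `n - f`. Then a round is chosen from which on no graph contains `d`.
  by_cases hd : d ∈ (E.fair P R u).final
  · obtain ⟨u', L', A', hc', hnot⟩ :=
      exists_commit_forall_not_mem_nodes hE hOrder hValidity hR hd
    exact ⟨u', L', A', hc', fun t' G hG hLG hdG => absurd hdG (hnot t' G hG hLG)⟩
  refine ⟨u, L, A, hc, fun t' G hG hLG hdG => ?_⟩
  have hut : u < t' := by
    by_contra hle
    exact absurd hLG (not_le.2 (round_lt_of_commit hOrder hR (not_lt.1 hle) hc
      (List.mem_append.2 (List.mem_append.1 hG).symm)))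
  have hap : n - P.f ≤ (E.fair P R t').ap d G.round := ap_ge_of_rounds_le hE fun j hj =>
    (hu hd t' hut j hj).trans (Nat.cast_le.2 hLG)
  rcases List.mem_append.1 hG with hG | hG
  · exact (inv_fair hOrder hR t').1.solid G hG d hdG hap
  · exact ((inv_fair hOrder hR t').1.ordered G hG d hdG hap).2

/-- Only digests occurring in the current subdag are classified. The subdag that completes the
correct indicators does contain the digest, and `ap ≥ n - f` then holds, so its node is no longer
blank. -/
theorem exists_mem_final_of_receive {T : Txn} (hT : P.valid T = true) {i : Fin n}
    (hi : i ∈ E.correct) {t : ℕ} (h : E.event i t = .receive T) :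
    ∃ t', P.digest T ∈ (E.fair P R t').final := by
  by_contra! hno
  obtain ⟨u, L, A, hc, ⟨v, hv, k, hk⟩, hu⟩ := exists_commit_forall_rounds_le hE hOrder hValidity hR
    fun j hj => exists_takes_of_receive hReceipt hT hi h hj
  refine absurd (exists_mem_final_of_ne_blank hn hE hOrder hValidity hReceipt hR
    (t := u + 1) (d := P.digest T) ?_) (by simpa using hno)
  have hap := ap_ge_of_rounds_le hE (hu (hno u) (u + 1) (Nat.lt_succ_self u))
  rw [fair_succ_of_commit hc] at hap ⊢
  refine ((inv_fair hOrder hR _).1.type_onSubdag_ne_blank_iff _ _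
    (fun _ hG => round_lt_of_commit hOrder hR le_rfl hc hG) _).2 (Or.inr ⟨?_, ?_⟩)
  · exact FairState.mem_updatedNodes_of_mem (hno _) hv hk
  · unfold FairState.ap at hap ⊢
    rw [FairState.rounds_onSubdag] at hap
    omega

end Liveness

end Execution

/-- For `γ ≤ 1` one has `2γ + 1 ≥ 3(2γ - 1)`, so the bound gives `n > 3f`. -/
theorem two_mul_lt_sub {n f : ℕ} {γ : ℝ} (hγ : 1 / 2 < γ) (hγ' : γ ≤ 1)
    (hn : (2 * γ + 1) * (f : ℝ) / (2 * γ - 1) < (n : ℝ)) : 2 * f < n - f := by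
  have h0 : 0 < 2 * γ - 1 := by linarith
  rw [div_lt_iff₀ h0] at hn
  have hf : (0 : ℝ) ≤ f := Nat.cast_nonneg f
  have h1 : (3 * (f : ℝ)) * (2 * γ - 1) < n * (2 * γ - 1) := by nlinarith
  have h2 : (3 * (f : ℝ)) < n := lt_of_mul_lt_mul_right h1 h0.le
  have h3 : 3 * f < n := by exact_mod_cast h2
  omega

end FairDAG

theorem mainTheorem6 {n : ℕ} {Txn D : Type*} [DecidableEq D]
    (P : FairDAG.Protocol n Txn D) (E : FairDAG.Execution n Txn D)
    (γ : ℝ) (hγ : 1 / 2 < γ) (hγ' : γ ≤ 1)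
    (hn : (2 * γ + 1) * (P.f : ℝ) / (2 * γ - 1) < (n : ℝ))
    (hE : E.Follows P)
    (hAgreement : E.Agreement) (hOrder : E.TotalAscendingOrder) (hValidity : E.Validity P)
    (hReceipt : E.EventualReceipt) :
    -- every valid transaction received by a correct replica is ordered by every correct replica
    (∀ T, P.valid T = true → (∃ R ∈ E.correct, ∃ t, E.event R t = .receive T) →
      ∀ R ∈ E.correct, ∃ t, P.digest T ∈ (E.fair P R t).final) ∧
    -- every dependency graph becomes a tournament, in a form that extends all its earlier forms
    (∀ R ∈ E.correct, ∀ t L A, E.event R t = .commit L A →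
      ∃ t', ∃ G ∈ (E.fair P R t').finalized, G.round = L.2 ∧ G.IsTournament ∧
        ∀ u, ∀ H ∈ (E.fair P R u).graphs, H.round = L.2 →
          H.nodes ⊆ G.nodes ∧ H.edges ⊆ G.edges) ∧
    -- every node that is once shaded or solid is ordered, and from some committed round on,
    -- it is solid in each graph to which it is added
    (∀ R ∈ E.correct, ∀ t d, (E.fair P R t).type d ≠ .blank →
      (∃ t', d ∈ (E.fair P R t').final) ∧
      ∃ u L A, E.event R u = .commit L A ∧
        ∀ t', ∀ G ∈ (E.fair P R t').graphs ++ (E.fair P R t').finalized,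
          L.2 ≤ G.round → d ∈ G.nodes → (E.fair P R t').type d = .solid) := by
  have hn' := FairDAG.two_mul_lt_sub hγ hγ' hn
  refine ⟨fun T hT ⟨i, hi, t, ht⟩ R hR => ?_, fun R hR t L A hc => ?_, fun R hR t d hd => ?_⟩
  · exact FairDAG.Execution.exists_mem_final_of_receive hn' hE hOrder hValidity hReceipt hR
      hT hi ht
  · exact FairDAG.Execution.exists_finalized_tournament hn' hE hOrder hValidity hReceipt hR hc
  · exact ⟨FairDAG.Execution.exists_mem_final_of_ne_blank hn' hE hOrder hValidity hReceipt hR hd,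
      FairDAG.Execution.exists_commit_forall_solid hn' hE hOrder hValidity hReceipt hR hd⟩
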